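/- Let $N\in\mathbb N$, let $|\cdot|$ be the Euclidean norm on $\mathbb R^N$, let $(\mathbb R^N)^+=\{x\in\mathbb R^N: x_i\ge 0 \text{ for all } i\}$ with the induced metric, and write $x\le y$ for the componentwise order. Let $f:\mathbb R\times\mathbb R^N\to\mathbb R^N$ be a Lipschitz Carathéodory function ($f\in\mathfrak{LC}$): $f$ is Borel measurable, and for every compact $K\subset\mathbb R^N$ there are real functions $m^K,l^K\in L^1_{loc}(\mathbb R)$ such that, for almost every $t\in\mathbb R$, $|f(t,x)|\le m^K(t)$ and $|f(t,x)-f(t,y)|\le l^K(t)\,|x-y|$ for all $x,y\in K$. Assume: (A1) if $x\ge 0$ and $x_i=0$, then $f_i(t,x)\ge 0$ for a.e. $t\in\mathbb R$; (A2) $f(t,x)\le A(t)x+b(t)$ for a.e. $(t,x)\in\mathbb R\times(\mathbb R^N)^+$, where $A=[a_{ij}]\in L^1_{loc}(\mathbb R,\mathbb R^{N\times N})$ has $a_{ij}\ge 0$ almost everywhere for all $i\ne j$, and $b\in L^1_{loc}(\mathbb R,\mathbb R^N)$ satisfies $b(t)\ge 0$ for every $t$; (A3) there are $\alpha_1>0$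 and $K\ge 1$ with $\|\Phi(t)\Phi^{-1}(s)\|\le K e^{-\alpha_1(t-s)}$ for all $s\le t\le 0$, where $\Phi$ is the fundamental matrix solution of $\dot y=A(t)y$ with $\Phi(0)=I$; (A4) for every $r>0$, $\sup_{t\in\mathbb R}\int_{-r}^{r}|b(u+t)|\,du<\infty$. Then for every $s\in\mathbb R$ and $x_0\in(\mathbb R^N)^+$ the Carathéodory Cauchy problem $\dot x=f(t,x)$, $x(s)=x_0$, has a unique forward solution, it is defined on $[s,\infty)$ and remains in $(\mathbb R^N)^+$, and, denoting by $S(t,s)x_0$ its value at time $t\ge s$, $S$ is a process on $X=(\mathbb R^N)^+$: $S(t,t)=\mathrm{id}$, $S(t,s)=S(t,r)S(r,s)$ for $t\ge r\ge s$, and $(t,s,x)\mapsto S(t,s)x$ is continuous on $\{t\ge s\}\times X$. Moreover: (i) For every $\tau\in\mathbb R$, $S$ is strongly pullback bounded dissipative on $(-\infty,\tau]$: there is a family $\{B(t)\}_{t\in\mathbb R}$ of nonempty bounded subsets of $X$ such that for every $t\in\mathbb R$ and every bounded $D\subset X$ there is $T(t,D)>0$ with $S(t,t-s)D\subset B(t)$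 for all $s\ge T(t,D)$, and such that for every bounded $D\subset X$ there is $T'(\tau,D)>0$ with $S(t,t-s)D\subset B(\tau)$ for all $t\le\tau$ and all $s\ge T'(\tau,D)$. (ii) $S$ has a pullback attractor $\{\mathcal A(t)\}_{t\in\mathbb R}$ that is bounded in the past. That is: each $\mathcal A(t)\subset X$ is compact; $S(t,s)\mathcal A(s)=\mathcal A(t)$ for $t\ge s$; for every $t$ and every bounded $D\subset X$, $\lim_{s\to-\infty}\sup_{x\in S(t,s)D}\inf_{y\in\mathcal A(t)}|x-y|=0$; $\mathcal A(t)\subset C(t)$ for all $t$ whenever $\{C(t)\}_{t\in\mathbb R}$ is a family of closed subsets of $X$ with this attraction property; and $\bigcup_{t\le\tau}\mathcal A(t)$ is bounded for every $\tau\in\mathbb R$. -/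

import Mathlib

open MeasureTheory Filter Topology
open scoped ENNReal

noncomputable section

namespace PullbackCone

/-! ### Processes and pullback attractors on a metric space -/

section PullbackDynamics

variable {X : Type*} [MetricSpace X]

/-- A process on `X`. Only the values `S t s` with `s ≤ t` are meaningful. -/
structure IsProcess (S : ℝ → ℝ → X → X) : Prop where
  self : ∀ (t : ℝ) (x : X), S t t x = x
  comp : ∀ (s r t : ℝ), s ≤ r → r ≤ t → ∀ x : X, S t s x = S t r (S r s x)
  cont : ContinuousOn (fun p : ℝ × ℝ × X => S p.1 p.2.1 p.2.2) {p | p.2.1 ≤ p.1}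

/-- The Hausdorff semi-distance `sup_{x ∈ A} inf_{y ∈ B} d(x, y)`, with values in `[0, ∞]`. -/
def semiDist (A B : Set X) : ℝ≥0∞ := ⨆ x ∈ A, Metric.infEDist x B

/-- The family `𝒜` pullback attracts every bounded set, at every time `t`. -/
def PullbackAttracts (S : ℝ → ℝ → X → X) (𝒜 : ℝ → Set X) : Prop :=
  ∀ (t : ℝ) (D : Set X), Bornology.IsBounded D →
    Tendsto (fun s : ℝ => semiDist (S t s '' D) (𝒜 t)) atBot (𝓝 0)

/-- Pullback attractor: compact, invariant, pullback attracting, and minimal among the families of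
closed sets that pullback attract bounded sets. -/
structure IsPullbackAttractor (S : ℝ → ℝ → X → X) (𝒜 : ℝ → Set X) : Prop where
  compact : ∀ t : ℝ, IsCompact (𝒜 t)
  invariant : ∀ s t : ℝ, s ≤ t → S t s '' 𝒜 s = 𝒜 t
  attracts : PullbackAttracts S 𝒜
  minimal : ∀ C : ℝ → Set X, (∀ t : ℝ, IsClosed (C t)) → PullbackAttracts S C →
    ∀ t : ℝ, 𝒜 t ⊆ C t

/-- A family is bounded in the past when its union over each half-line `(-∞, τ]` is bounded. -/
def BoundedInPast (𝒜 : ℝ → Set X) : Prop :=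
  ∀ τ : ℝ, Bornology.IsBounded (⋃ t ∈ Set.Iic τ, 𝒜 t)

/-- `B` is a pullback bounded absorbing family of the process `S`. -/
structure IsPullbackAbsorbing (S : ℝ → ℝ → X → X) (B : ℝ → Set X) : Prop where
  nonempty : ∀ t : ℝ, (B t).Nonempty
  bounded : ∀ t : ℝ, Bornology.IsBounded (B t)
  absorbs : ∀ (t : ℝ) (D : Set X), Bornology.IsBounded D →
    ∃ T : ℝ, 0 < T ∧ ∀ s : ℝ, T ≤ s → S t (t - s) '' D ⊆ B t

/-- `S` is strongly pullback bounded dissipative on `(-∞, τ]`. -/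
def StronglyPullbackBoundedDissipative (S : ℝ → ℝ → X → X) (τ : ℝ) : Prop :=
  ∃ B : ℝ → Set X, IsPullbackAbsorbing S B ∧
    ∀ D : Set X, Bornology.IsBounded D →
      ∃ T : ℝ, 0 < T ∧ ∀ t s : ℝ, t ≤ τ → T ≤ s → S t (t - s) '' D ⊆ B τ

end PullbackDynamics

/-! ### Carathéodory equations -/

/-- `ℝ^N` with its Euclidean norm. -/
abbrev E (N : ℕ) : Type := EuclideanSpace ℝ (Fin N)

/-- The positive cone `(ℝ^N)⁺`, with the metric induced from `ℝ^N`. -/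
abbrev Cone (N : ℕ) : Type := {x : E N // ∀ i : Fin N, 0 ≤ x i}

/-- Lipschitz Carathéodory functions `f : ℝ × ℝ^N → ℝ^N`. -/
structure IsLC {N : ℕ} (f : ℝ → E N → E N) : Prop where
  measurable : Measurable (fun p : ℝ × E N => f p.1 p.2)
  mBound : ∀ K : Set (E N), IsCompact K → ∃ m : ℝ → ℝ, LocallyIntegrable m volume ∧
    ∀ᵐ t : ℝ, ∀ x ∈ K, ‖f t x‖ ≤ m t
  lBound : ∀ K : Set (E N), IsCompact K → ∃ l : ℝ → ℝ, LocallyIntegrable l volume ∧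
    ∀ᵐ t : ℝ, ∀ x ∈ K, ∀ y ∈ K, ‖f t x - f t y‖ ≤ l t * ‖x - y‖

/-- `x` is, on the interval `J` with left end point `s ∈ J`, a Carathéodory solution of
`x' = f(t, x)`, `x(s) = x₀`. -/
structure IsSolutionOn {N : ℕ} (f : ℝ → E N → E N) (s : ℝ) (x₀ : E N) (J : Set ℝ)
    (x : ℝ → E N) : Prop where
  cont : ContinuousOn x J
  integrable : ∀ t ∈ J, IntervalIntegrable (fun u : ℝ => f u (x u)) volume s t
  eqn : ∀ t ∈ J, x t = x₀ + ∫ u in s..t, f u (x u)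

/-- `S` is the process on the positive cone induced by `x' = f(t, x)`: for every `s` and every
`x₀ ≥ 0` the function `t ↦ S t s x₀` is the solution on `[s, ∞)` that starts at time `s` from `x₀`,
and every solution of the same Cauchy problem in `ℝ^N`, on any `[s, T]`, coincides with it. -/
structure IsInducedProcess {N : ℕ} (f : ℝ → E N → E N) (S : ℝ → ℝ → Cone N → Cone N) : Prop where
  process : IsProcess S
  solution : ∀ (s : ℝ) (x₀ : Cone N),
    IsSolutionOn f s (x₀ : E N) (Set.Ici s) (fun t : ℝ => (S t s x₀ : E N))
  unique : ∀ (s T : ℝ) (x₀ : Cone N) (y : ℝ → E N),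
    IsSolutionOn f s (x₀ : E N) (Set.Icc s T) y → ∀ t ∈ Set.Icc s T, y t = (S t s x₀ : E N)

/-! ### The hypotheses on the vector field -/

/-- If `x ≥ 0` and `x_i = 0`, then `f_i(t, x) ≥ 0` for almost every `t`. -/
def CondA1 {N : ℕ} (f : ℝ → E N → E N) : Prop :=
  ∀ (x : E N) (i : Fin N), (∀ j : Fin N, 0 ≤ x j) → x i = 0 → ∀ᵐ t : ℝ, 0 ≤ f t x i

/-- `f(t, x) ≤ A(t) x + b(t)` componentwise for almost every `(t, x)` with `x ≥ 0`, where `A`, `b`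
are locally integrable, `A` has nonnegative off-diagonal entries and `b ≥ 0`. -/
structure CondA2 {N : ℕ} (f : ℝ → E N → E N) (A : ℝ → Matrix (Fin N) (Fin N) ℝ)
    (b : ℝ → E N) : Prop where
  locInt_A : ∀ i j : Fin N, LocallyIntegrable (fun t : ℝ => A t i j) volume
  quasiMonotone : ∀ i j : Fin N, i ≠ j → ∀ᵐ t : ℝ, 0 ≤ A t i j
  locInt_b : LocallyIntegrable b volume
  nonneg_b : ∀ (t : ℝ) (i : Fin N), 0 ≤ b t i
  le : ∀ᵐ p : ℝ × E N, (∀ j : Fin N, 0 ≤ p.2 j) →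
    ∀ i : Fin N, f p.1 p.2 i ≤ (∑ j : Fin N, A p.1 i j * p.2 j) + b p.1 i

/-- `Φ` is the fundamental matrix solution of `y' = A(t) y` with `Φ(0) = I`. -/
structure IsFundamentalMatrix {N : ℕ} (A Φ : ℝ → Matrix (Fin N) (Fin N) ℝ) : Prop where
  cont : Continuous Φ
  eqn : ∀ (t : ℝ) (i j : Fin N),
    Φ t i j = (1 : Matrix (Fin N) (Fin N) ℝ) i j + ∫ u in (0 : ℝ)..t, (A u * Φ u) i j

/-- `y' = A(t) y` has exponential dichotomy on `(-∞, 0]` with projection the identity. The norm is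
the operator norm associated with the Euclidean norm. -/
def CondA3 {N : ℕ} (A : ℝ → Matrix (Fin N) (Fin N) ℝ) : Prop :=
  ∃ Φ : ℝ → Matrix (Fin N) (Fin N) ℝ, IsFundamentalMatrix A Φ ∧
    ∃ α₁ K : ℝ, 0 < α₁ ∧ 1 ≤ K ∧ ∀ s t : ℝ, s ≤ t → t ≤ 0 →
      ‖Matrix.toEuclideanCLM (n := Fin N) (𝕜 := ℝ) (Φ t * (Φ s)⁻¹)‖
        ≤ K * Real.exp (-α₁ * (t - s))

/-- The set of the translates `b_t = b(· + t)`, `t ∈ ℝ`, is bounded in `L¹_loc`. -/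
def CondA4 {N : ℕ} (b : ℝ → E N) : Prop :=
  ∀ r : ℝ, 0 < r → ∃ C : ℝ, ∀ t : ℝ, (∫ u in (-r)..r, ‖b (u + t)‖) ≤ C

end PullbackCone

end

noncomputable section

namespace PullbackCone

/-! ### Absolutely continuous functions and an integral Gronwall inequality -/

section Gronwall

open Set

/-! On the cone the nonlinear equation lies below the linear one `y' = A(t) y + b(t)`. Since `A` is
quasimonotone, linear differential inequalities preserve order (`CondA2.nonneg_of_linear_le`), so a
nonnegative solution satisfies `0 ≤ x ≤ y` componentwise, where `y` is given by variation of
constants. The Euclidean norm is monotone on the cone, so for times `t ≤ 0` the exponential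
dichotomy bounds `‖x t‖` by a decaying multiple of `‖x₀‖` plus a convolution of `‖b‖` with a
decaying exponential. That convolution is bounded uniformly because `b` is translation bounded
(`exists_integral_exp_mul_le`). Hence one ball absorbs all bounded sets, uniformly in the final time
`t ≤ 0`; later times are reached by flowing this ball over the compact interval `[0, τ]`.

Global existence uses the same one-sided bound. The field is truncated to a box, where a weighted
contraction applies. Nonnegativity and the a priori bound hold for the truncated solution with
constants that do not involve the truncation level, so a box of the right size makes the truncation
inactive. Uniqueness and continuous dependence are Gronwall estimates.

The attractor is then abstract: the pullback omega-limit of a single absorbing ball is compact,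
invariant, minimal, and contained in the absorbing balls, which bounds it in the past. -/

theorem _root_.LipschitzOnWith.comp_absolutelyContinuousOnInterval {f φ : ℝ → ℝ} {a b : ℝ}
    {K : NNReal} (hφ : LipschitzOnWith K φ (f '' uIcc a b))
    (hf : AbsolutelyContinuousOnInterval f a b) :
    AbsolutelyContinuousOnInterval (fun x => φ (f x)) a b := by
  rw [absolutelyContinuousOnInterval_iff] at hf ⊢
  intro ε hε
  obtain ⟨δ, hδ, h⟩ := hf (ε / (K + 1)) (by positivity)
  refine ⟨δ, hδ, fun E hE hEδ => ?_⟩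
  have h1 := h E hE hEδ
  calc ∑ i ∈ Finset.range E.1, dist (φ (f (E.2 i).1)) (φ (f (E.2 i).2))
      ≤ ∑ i ∈ Finset.range E.1, K * dist (f (E.2 i).1) (f (E.2 i).2) := by
        refine Finset.sum_le_sum fun i hi => hφ.dist_le_mul _ ?_ _ ?_
        · exact mem_image_of_mem _ (hE.1 i hi).1
        · exact mem_image_of_mem _ (hE.1 i hi).2
    _ = K * ∑ i ∈ Finset.range E.1, dist (f (E.2 i).1) (f (E.2 i).2) := by
        rw [Finset.mul_sum]
    _ ≤ K * (ε / (K + 1)) := by gcongr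
    _ < ε := by
        rw [mul_div_assoc', div_lt_iff₀ (by positivity)]
        nlinarith [K.2]

theorem absolutelyContinuousOnInterval_exp {f : ℝ → ℝ} {a b : ℝ}
    (hf : AbsolutelyContinuousOnInterval f a b) :
    AbsolutelyContinuousOnInterval (fun x => Real.exp (f x)) a b := by
  obtain ⟨C, hC⟩ := hf.exists_bound
  obtain ⟨K, hK⟩ := Real.contDiff_exp.contDiffOn (n := 1) (s := Icc (-C) C)
    |>.exists_lipschitzOnWith one_ne_zero (convex_Icc _ _) isCompact_Icc
  refine (hK.mono ?_).comp_absolutelyContinuousOnInterval hf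
  rintro _ ⟨x, hx, rfl⟩
  exact abs_le.1 (hC x hx)

theorem integral_mul_exp_integral {l : ℝ → ℝ} {a b : ℝ} (hl : IntervalIntegrable l volume a b)
    (c : ℝ) :
    ∫ u in a..b, c * l u * Real.exp (c * ∫ v in a..u, l v) =
      Real.exp (c * ∫ v in a..b, l v) - 1 := by
  have hΛ := hl.absolutelyContinuousOnInterval_intervalIntegral (c := a) (by simp)
  have hE := absolutelyContinuousOnInterval_exp (hΛ.const_mul c)
  have h := hE.integral_deriv_eq_sub
  simp only [intervalIntegral.integral_same, mul_zero, Real.exp_zero] at h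
  rw [← h]
  refine intervalIntegral.integral_congr_ae ?_
  filter_upwards [hl.ae_hasDerivAt_integral] with x hx hxab
  have h1 := ((hx (uIoc_subset_uIcc hxab) a (by simp)).const_mul c).exp
  rw [h1.deriv]
  ring

/-- Gronwall's inequality with an integrable weight. -/
theorem le_mul_exp_integral_of_le_add_integral {l v : ℝ → ℝ} {a b c : ℝ} (hab : a ≤ b)
    (hl : IntervalIntegrable l volume a b) (hl0 : ∀ t, 0 ≤ l t) (hv : ContinuousOn v (Icc a b))
    (h : ∀ t ∈ Icc a b, v t ≤ c + ∫ u in a..t, l u * v u) :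
    ∀ t ∈ Icc a b, v t ≤ c * Real.exp (∫ u in a..t, l u) := by
  intro t ht
  have hsub : uIcc a t ⊆ uIcc a b := by
    rw [uIcc_of_le ht.1, uIcc_of_le hab]; exact Icc_subset_Icc le_rfl ht.2
  have hlt : IntervalIntegrable l volume a t := hl.mono_set hsub
  have hvt : ContinuousOn v (uIcc a t) := hv.mono (by rwa [uIcc_of_le hab] at hsub)
  have hlv : IntervalIntegrable (fun u => l u * v u) volume a t := hlt.mul_continuousOn hvt
  set H : ℝ → ℝ := fun x => ∫ u in a..x, l u * v u
  set Λ : ℝ → ℝ := fun x => ∫ u in a..x, l u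
  have hH : AbsolutelyContinuousOnInterval H a t :=
    hlv.absolutelyContinuousOnInterval_intervalIntegral (by simp)
  have hΛ : AbsolutelyContinuousOnInterval Λ a t :=
    hlt.absolutelyContinuousOnInterval_intervalIntegral (by simp)
  -- Integrating factor: `(c + H) * exp (-Λ)` has nonpositive derivative almost everywhere, and
  -- absolute continuity turns this into a decrease from `a` to `t`.
  have hG : AbsolutelyContinuousOnInterval (fun x => Real.exp (-1 * Λ x)) a t :=
    absolutelyContinuousOnInterval_exp (hΛ.const_mul (-1))
  have hc : AbsolutelyContinuousOnInterval (fun x => c + H x) a t := by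
    have : AbsolutelyContinuousOnInterval (fun _ : ℝ => c) a t :=
      ((LipschitzWith.const c).lipschitzOnWith (s := uIcc a t)).absolutelyContinuousOnInterval
    exact this.add hH
  have key := (hc.fun_mul hG).integral_deriv_eq_sub
  have hneg : ∫ x in a..t, deriv (fun x => (c + H x) * Real.exp (-1 * Λ x)) x ≤ 0 := by
    have : (0 : ℝ) = ∫ x in a..t, (0 : ℝ) := by simp
    rw [this]
    refine intervalIntegral.integral_mono_ae_restrict ht.1
      (hc.fun_mul hG).intervalIntegrable_deriv (by simp) ?_
    refine (ae_restrict_iff' measurableSet_Icc).2 ?_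
    filter_upwards [hlv.ae_hasDerivAt_integral, hlt.ae_hasDerivAt_integral] with x h1 h2 hx
    have hx' : x ∈ uIcc a t := by rwa [uIcc_of_le ht.1]
    have d := ((h1 hx' a (by simp)).const_add c).mul (((h2 hx' a (by simp)).const_mul (-1)).exp)
    have := d.deriv
    simp only [Pi.mul_def] at this
    change deriv (fun x => (c + H x) * Real.exp (-1 * Λ x)) x ≤ 0
    rw [show deriv (fun x => (c + H x) * Real.exp (-1 * Λ x)) x = _ from this]
    have hvx := h x ⟨hx.1, hx.2.trans ht.2⟩
    have e := Real.exp_pos (-1 * Λ x)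
    have : l x * (v x - (c + H x)) ≤ 0 :=
      mul_nonpos_of_nonneg_of_nonpos (hl0 x) (sub_nonpos.2 hvx)
    change l x * v x * Real.exp (-1 * Λ x) + (c + H x) * (Real.exp (-1 * Λ x) * (-1 * l x)) ≤ 0
    nlinarith [mul_nonpos_of_nonpos_of_nonneg this e.le]
  rw [key] at hneg
  have ha : H a = 0 := by simp [H]
  have ha' : Λ a = 0 := by simp [Λ]
  simp only [ha, ha', mul_zero, Real.exp_zero, add_zero, mul_one, sub_nonpos] at hneg
  have := h t ht
  have e := Real.exp_pos (Λ t)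
  have e1 : Real.exp (-1 * Λ t) * Real.exp (Λ t) = 1 := by
    rw [← Real.exp_add]; simp
  calc v t ≤ c + H t := this
    _ = ((c + H t) * Real.exp (-1 * Λ t)) * Real.exp (Λ t) := by rw [mul_assoc, e1, mul_one]
    _ ≤ c * Real.exp (Λ t) := by gcongr

/-- The product rule for indefinite integrals. -/
theorem mul_eq_add_integral_of_eq_add_integral {F G φ γ : ℝ → ℝ} {a b : ℝ} (hab : a ≤ b)
    (hφ : IntervalIntegrable φ volume a b) (hγ : IntervalIntegrable γ volume a b)
    (hF : ∀ t ∈ Icc a b, F t = F a + ∫ u in a..t, φ u)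
    (hG : ∀ t ∈ Icc a b, G t = G a + ∫ u in a..t, γ u) :
    F b * G b = F a * G a + ∫ u in a..b, (φ u * G u + F u * γ u) := by
  have hc (c : ℝ) : AbsolutelyContinuousOnInterval (fun _ : ℝ => c) a b :=
    ((LipschitzWith.const c).lipschitzOnWith (s := uIcc a b)).absolutelyContinuousOnInterval
  have h1 := (hc (F a)).add
    (hφ.absolutelyContinuousOnInterval_intervalIntegral (c := a) (by simp))
  have h2 := (hc (G a)).add
    (hγ.absolutelyContinuousOnInterval_intervalIntegral (c := a) (by simp))
  have h := h1.integral_deriv_mul_eq_sub h2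
  simp only [Pi.add_apply, intervalIntegral.integral_same, add_zero] at h
  rw [← hF b ⟨hab, le_rfl⟩, ← hG b ⟨hab, le_rfl⟩] at h
  rw [← sub_eq_iff_eq_add', ← h]
  refine intervalIntegral.integral_congr_ae ?_
  filter_upwards [hφ.ae_hasDerivAt_integral, hγ.ae_hasDerivAt_integral] with x d1 d2 hx
  have hx' := uIoc_subset_uIcc hx
  have e1 := ((d1 hx' a (by simp)).const_add (F a)).deriv
  have e2 := ((d2 hx' a (by simp)).const_add (G a)).deriv
  rw [uIcc_of_le hab] at hx'
  rw [hF x hx', hG x hx']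
  congr 2

end Gronwall

/-! ### Pullback attractors of processes with a uniformly absorbing family of balls -/

section Attractor

open Set Metric

variable {X : Type*} [MetricSpace X]

theorem IsProcess.continuous_apply {S : ℝ → ℝ → X → X} (hS : IsProcess S) {s t : ℝ}
    (hst : s ≤ t) : Continuous (S t s) := by
  have h : ContinuousOn (fun x : X => S t s x) univ :=
    hS.cont.comp (f := fun x : X => (t, s, x)) (by fun_prop) (fun _ _ => hst)
  exact continuousOn_univ.1 h

/-- Bounded sets are absorbed, uniformly for final times in `(-∞, τ]`, by a ball around `p`
of radius `R τ`. -/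
def UniformlyAbsorbedByBalls (S : ℝ → ℝ → X → X) (p : X) (R : ℝ → ℝ) : Prop :=
  ∀ (τ : ℝ) (D : Set X), Bornology.IsBounded D → ∃ T : ℝ, 0 < T ∧
    ∀ t s : ℝ, t ≤ τ → T ≤ s → S t (t - s) '' D ⊆ closedBall p (R τ)

theorem UniformlyAbsorbedByBalls.stronglyPullbackBoundedDissipative {S : ℝ → ℝ → X → X} {p : X}
    {R : ℝ → ℝ} (h : UniformlyAbsorbedByBalls S p R) (τ : ℝ) :
    StronglyPullbackBoundedDissipative S τ := by
  have hR : ∀ t, 0 ≤ R t := fun t => by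
    obtain ⟨T, -, hT⟩ := h t {p} Bornology.isBounded_singleton
    have := hT t T le_rfl le_rfl (mem_image_of_mem _ rfl)
    exact dist_nonneg.trans this
  refine ⟨fun t => closedBall p (R t), ⟨fun t => ⟨p, mem_closedBall_self (hR t)⟩,
    fun t => isBounded_closedBall, fun t D hD => ?_⟩, fun D hD => h τ D hD⟩
  obtain ⟨T, hT0, hT⟩ := h t D hD
  exact ⟨T, hT0, fun s hs => hT t s le_rfl hs⟩

theorem tendsto_semiDist_zero_of_eventually_subset {F : ℝ → Set X} {B : Set X}
    (h : ∀ U : Set X, IsOpen U → B ⊆ U → ∀ᶠ s in atBot, F s ⊆ U) :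
    Tendsto (fun s => semiDist (F s) B) atBot (𝓝 0) := by
  rw [ENNReal.tendsto_nhds_zero]
  intro ε hε
  have hU := h {x | infEDist x B < ε} (isOpen_lt continuous_infEDist continuous_const)
    (fun x hx => by simpa [infEDist_zero_of_mem hx] using hε)
  filter_upwards [hU] with s hs
  exact iSup₂_le fun x hx => (hs hx).le

variable [ProperSpace X]

/-- The omega-limit of one fixed ball suffices: absorption is uniform in the final time on `(-∞,
0]`, so every bounded set has entered that ball at any prescribed time `σ ≤ 0` if it starts early
enough. Properness makes the absorbing balls compact. -/
theorem UniformlyAbsorbedByBalls.exists_isPullbackAttractor {S : ℝ → ℝ → X → X} {p : X}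
    {R : ℝ → ℝ} (hS : IsProcess S) (h : UniformlyAbsorbedByBalls S p R) :
    ∃ 𝒜 : ℝ → Set X, IsPullbackAttractor S 𝒜 ∧ BoundedInPast 𝒜 := by
  set B : Set X := closedBall p (R 0)
  have hB : Bornology.IsBounded B := isBounded_closedBall
  have habs : ∀ {τ t : ℝ}, t ≤ τ → ∀ᶠ s in atBot, MapsTo (S t s) B (closedBall p (R τ)) := by
    intro τ t ht
    obtain ⟨T, -, hT⟩ := h τ B hB
    filter_upwards [eventually_le_atBot (t - T)] with s hs x hx
    have := hT t (t - s) ht (by linarith)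
    rw [sub_sub_cancel] at this
    exact this (mem_image_of_mem _ hx)
  set 𝒜 : ℝ → Set X := fun t => omegaLimit atBot (fun s x => S t s x) B
  have hsub : ∀ {τ t : ℝ}, t ≤ τ → 𝒜 t ⊆ closedBall p (R τ) := by
    intro τ t ht
    refine (omegaLimit_subset_closure_image2 _ _ _ (habs ht)).trans ?_
    refine closure_minimal ?_ isClosed_closedBall
    rintro _ ⟨s, hs, x, hx, rfl⟩
    exact hs hx
  have hnhds : ∀ (t : ℝ) (U : Set X), IsOpen U → 𝒜 t ⊆ U → ∀ᶠ s in atBot, MapsTo (S t s) B U :=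
    fun t U hU hAU => eventually_mapsTo_of_isCompact_absorbing_of_isOpen_of_omegaLimit_subset
      atBot (fun s x => S t s x) B (isCompact_closedBall p (R t)) (habs le_rfl) hU hAU
  have hcpt : ∀ t, IsCompact (𝒜 t) := fun t =>
    (isCompact_closedBall p (R t)).of_isClosed_subset (isClosed_omegaLimit _ _ _) (hsub le_rfl)
  refine ⟨𝒜, ⟨hcpt, fun s t hst => ?_, fun t D hD => ?_, fun C hC hCa t y hy => ?_⟩,
    fun τ => isBounded_closedBall.subset (iUnion₂_subset fun t ht => hsub ht)⟩
  · have hcont := hS.continuous_apply hst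
    apply Subset.antisymm
    · rintro _ ⟨y, hy, rfl⟩
      simp only [𝒜, mem_omegaLimit_iff_frequently] at hy ⊢
      intro n hn
      refine ((hy _ (hcont.continuousAt.preimage_mem_nhds hn)).and_eventually
        (eventually_le_atBot s)).mono ?_
      rintro σ ⟨⟨x, hx, hxn⟩, hσ⟩
      refine ⟨x, hx, ?_⟩
      simpa [hS.comp σ s t hσ hst] using hxn
    -- If `y` were outside the compact image, separate the two by open sets. At time `s` the
    -- trajectories from `B` eventually lie in the preimage of `U`, so at time `t` they lie in `U`
    -- and cannot return frequently to `V`.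
    · intro y hy
      by_contra hyC
      have hC : IsClosed (S t s '' 𝒜 s) := ((hcpt s).image hcont).isClosed
      obtain ⟨U, V, hU, hV, hCU, hyV, hUV⟩ :=
        SeparatedNhds.of_isCompact_isClosed ((hcpt s).image hcont) (isClosed_singleton (x := y))
          (disjoint_singleton_right.2 hyC)
      have hev := hnhds s (S t s ⁻¹' U) (hU.preimage hcont) (image_subset_iff.1 hCU)
      have hfr := (mem_omegaLimit_iff_frequently _ _ _ _).1 hy V
        (hV.mem_nhds (hyV rfl))
      obtain ⟨σ, ⟨x, hx, hxV⟩, hσU, hσ⟩ :=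
        (hfr.and_eventually (hev.and (eventually_le_atBot s))).exists
      have h1 : S t σ x ∈ U := by
        rw [hS.comp σ s t hσ hst]; exact hσU hx
      exact hUV.le_bot ⟨h1, hxV⟩
  · refine tendsto_semiDist_zero_of_eventually_subset fun U hU hAU => ?_
    -- First fix an intermediate time `σ` from which `B` is carried into `U`; then start so early
    -- that `D` is inside `B` at time `σ`.
    obtain ⟨σ, hσU, hσt, hσ0⟩ := ((hnhds t U hU hAU).and
      ((eventually_le_atBot t).and (eventually_le_atBot 0))).exists
    obtain ⟨T, hT0, hT⟩ := h 0 D hD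
    filter_upwards [eventually_le_atBot (σ - T)] with s hs
    rintro _ ⟨x, hx, rfl⟩
    rw [hS.comp s σ t (by linarith) hσt]
    have := hT σ (σ - s) hσ0 (by linarith)
    rw [sub_sub_cancel] at this
    exact hσU (this (mem_image_of_mem _ hx))
  · rw [← (hC t).closure_eq, mem_closure_iff_infEDist_zero]
    refine le_antisymm (ENNReal.le_of_forall_pos_le_add fun ε hε _ => ?_) bot_le
    have hε' : (0 : ℝ≥0∞) < ε / 2 := by simp [hε.ne']
    have hev := (ENNReal.tendsto_nhds_zero.1 (hCa t B hB)) (ε / 2) hε'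
    have hfr := (mem_omegaLimit_iff_frequently _ _ _ _).1 hy (eball y (ε / 2))
      (eball_mem_nhds y hε')
    obtain ⟨σ, ⟨x, hx, hxy⟩, hσ⟩ := (hfr.and_eventually hev).exists
    have h1 : infEDist (S t σ x) (C t) ≤ ε / 2 :=
      (le_iSup₂ (f := fun z (_ : z ∈ S t σ '' B) => infEDist z (C t)) _
        (mem_image_of_mem _ hx)).trans hσ
    have h2 : edist y (S t σ x) < ε / 2 := by rw [edist_comm]; exact hxy
    calc infEDist y (C t) ≤ infEDist (S t σ x) (C t) + edist y (S t σ x) :=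
          infEDist_le_infEDist_add_edist
      _ ≤ ε / 2 + ε / 2 := add_le_add h1 h2.le
      _ = 0 + ε := by rw [ENNReal.add_halves, zero_add]

end Attractor

/-! ### Existence for globally Lipschitz Carathéodory equations -/

section Existence

open Set

theorem _root_.MeasureTheory.LocallyIntegrable.intervalIntegrable_real {F : Type*}
    [NormedAddCommGroup F] {f : ℝ → F} (hf : LocallyIntegrable f volume) (a b : ℝ) :
    IntervalIntegrable f volume a b :=
  (hf.integrableOn_isCompact isCompact_uIcc).intervalIntegrable

theorem intervalIntegrable_comp_of_norm_le {N : ℕ} {g : ℝ → E N → E N}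
    (hg : Measurable (fun p : ℝ × E N => g p.1 p.2)) {m : ℝ → ℝ} {x : ℝ → E N} {a b : ℝ}
    (hm : IntervalIntegrable m volume a b) (hx : ContinuousOn x (uIcc a b))
    (h : ∀ᵐ u, u ∈ uIcc a b → ‖g u (x u)‖ ≤ m u) :
    IntervalIntegrable (fun u => g u (x u)) volume a b := by
  refine hm.mono_fun' ?_ ?_
  · have h1 : AEMeasurable x (volume.restrict (uIcc a b)) := hx.aemeasurable measurableSet_uIcc
    have h2 : AEMeasurable (fun u => g u (x u)) (volume.restrict (uIcc a b)) :=
      hg.comp_aemeasurable (aemeasurable_id.prodMk h1)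
    exact (h2.mono_measure (Measure.restrict_mono uIoc_subset_uIcc le_rfl)).aestronglyMeasurable
  · refine (ae_restrict_iff' measurableSet_uIoc).2 ?_
    filter_upwards [h] with u hu hu'
    exact hu (uIoc_subset_uIcc hu')

/-- Picard iteration in the unknown `z = exp (-lam) • x`, which amounts to a weighted sup norm. The
weight makes the integral operator a contraction on the whole of `[s, T]` at once, without
subdividing the interval. -/
theorem exists_isSolutionOn_of_lipschitz {N : ℕ} {g : ℝ → E N → E N} {l m : ℝ → ℝ}
    (hg : Measurable (fun p : ℝ × E N => g p.1 p.2))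
    (hl : LocallyIntegrable l volume) (hl0 : ∀ t, 0 ≤ l t) (hm : LocallyIntegrable m volume)
    (hgm : ∀ᵐ t, ∀ x, ‖g t x‖ ≤ m t)
    (hgl : ∀ᵐ t, ∀ x y, ‖g t x - g t y‖ ≤ l t * ‖x - y‖)
    {s T : ℝ} (hsT : s ≤ T) (x₀ : E N) :
    ∃ x : ℝ → E N, IsSolutionOn g s x₀ (Icc s T) x := by
  have hlI : ∀ a b, IntervalIntegrable l volume a b := hl.intervalIntegrable_real
  -- The factor `2` produces the contraction constant `1 / 2`, since `l * exp lam` integrates to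
  -- `(exp lam - 1) / 2`.
  set lam : ℝ → ℝ := fun t => 2 * ∫ u in s..t, l u with hlam
  have hlamc : Continuous lam :=
    continuous_const.mul (intervalIntegral.continuous_primitive hlI s)
  set ext : C(Icc s T, E N) → ℝ → E N := fun z u => Real.exp (lam u) • z (projIcc s T hsT u)
  have hext : ∀ z, Continuous (ext z) := fun z => by
    have : Continuous (fun u => z (projIcc s T hsT u)) := z.continuous.comp continuous_projIcc
    fun_prop
  have hint : ∀ z a b, IntervalIntegrable (fun u => g u (ext z u)) volume a b := fun z a b => by
    refine intervalIntegrable_comp_of_norm_le hg (hm.intervalIntegrable_real a b) (hext z).continuousOn ?_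
    filter_upwards [hgm] with u hu _ using hu _
  have hop : ∀ z, Continuous
      (fun t => Real.exp (-lam t) • (x₀ + ∫ u in s..t, g u (ext z u))) := fun z => by
    have := intervalIntegral.continuous_primitive (hint z) s
    fun_prop
  set P : C(Icc s T, E N) → C(Icc s T, E N) := fun z =>
    ⟨fun t => Real.exp (-lam t) • (x₀ + ∫ u in s..(t : ℝ), g u (ext z u)),
      (hop z).comp continuous_subtype_val⟩
  have hP : ContractingWith (1 / 2) P := by
    refine ⟨by rw [← NNReal.coe_lt_coe]; norm_num, LipschitzWith.of_dist_le_mul fun z w => ?_⟩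
    rw [ContinuousMap.dist_le (by positivity)]
    rintro ⟨t, ht⟩
    have e0 := Real.exp_pos (-lam t)
    have e1 : Real.exp (-lam t) * Real.exp (lam t) = 1 := by rw [← Real.exp_add]; simp
    have hexp := integral_mul_exp_integral (hlI s t) 2
    have hb : ‖∫ u in s..t, (g u (ext z u) - g u (ext w u))‖ ≤
        ∫ u in s..t, (2 * l u * Real.exp (2 * ∫ v in s..u, l v)) * (dist z w / 2) := by
      refine intervalIntegral.norm_integral_le_of_norm_le ht.1 ?_ ?_
      · filter_upwards [hgl] with u hu _
        refine (hu _ _).trans ?_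
        have : ‖ext z u - ext w u‖ ≤ Real.exp (lam u) * dist z w := by
          simp only [ext]
          rw [← smul_sub, norm_smul, Real.norm_of_nonneg (Real.exp_pos _).le, ← dist_eq_norm]
          gcongr
          exact ContinuousMap.dist_apply_le_dist _
        calc l u * ‖ext z u - ext w u‖ ≤ l u * (Real.exp (lam u) * dist z w) :=
              mul_le_mul_of_nonneg_left this (hl0 u)
          _ = _ := by simp only [hlam]; ring
      · refine IntervalIntegrable.mul_const ?_ _
        exact ((hlI s t).const_mul 2).mul_continuousOn
          (Real.continuous_exp.comp hlamc).continuousOn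
    rw [intervalIntegral.integral_mul_const, hexp] at hb
    change dist (Real.exp (-lam t) • (x₀ + ∫ u in s..t, g u (ext z u)))
      (Real.exp (-lam t) • (x₀ + ∫ u in s..t, g u (ext w u))) ≤ _
    rw [dist_eq_norm, ← smul_sub, add_sub_add_left_eq_sub,
      ← intervalIntegral.integral_sub (hint z s t) (hint w s t), norm_smul,
      Real.norm_of_nonneg e0.le]
    calc _ ≤ Real.exp (-lam t) * ((Real.exp (lam t) - 1) * (dist z w / 2)) := by gcongr
      _ = (1 - Real.exp (-lam t)) * (dist z w / 2) := by rw [← mul_assoc, mul_sub, e1, mul_one]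
      _ ≤ 1 * (dist z w / 2) := by gcongr; linarith
      _ = _ := by push_cast; ring
  obtain ⟨z, hz⟩ : ∃ z, P z = z := ⟨_, hP.fixedPoint_isFixedPt⟩
  refine ⟨ext z, (hext z).continuousOn, fun t _ => hint z s t, fun t ht => ?_⟩
  have h1 : z ⟨t, ht⟩ = Real.exp (-lam t) • (x₀ + ∫ u in s..t, g u (ext z u)) := by
    conv_lhs => rw [← hz]
    rfl
  have e1 : Real.exp (lam t) * Real.exp (-lam t) = 1 := by rw [← Real.exp_add]; simp
  change Real.exp (lam t) • z (projIcc s T hsT t) = _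
  rw [projIcc_of_mem hsT ht, h1, smul_smul, e1, one_smul]

end Existence

/-! ### Nonnegativity, and the hypotheses for almost every time -/

section Nonneg

open Set

/-- Gronwall for the sum `v` of the negative parts, which starts at zero. It serves twice: with `l =
0` for invariance of the cone, and with `l = entrySum A` for the linear comparison. -/
theorem nonneg_of_integral_of_quasipositive {N : ℕ} {w φ : Fin N → ℝ → ℝ} {l : ℝ → ℝ} {s T : ℝ}
    (hl : LocallyIntegrable l volume) (hl0 : ∀ t, 0 ≤ l t)
    (hw : ∀ i, ContinuousOn (w i) (Icc s T))
    (hφ : ∀ i, IntervalIntegrable (φ i) volume s T)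
    (heq : ∀ i, ∀ t ∈ Icc s T, w i t = w i s + ∫ u in s..t, φ i u)
    (h0 : ∀ i, 0 ≤ w i s)
    (h : ∀ᵐ u, u ∈ Icc s T → ∀ i, w i u ≤ 0 → -(l u * ∑ j, max (-w j u) 0) ≤ φ i u) :
    ∀ t ∈ Icc s T, ∀ i, 0 ≤ w i t := by
  intro T' hT'
  have hsT : s ≤ T := hT'.1.trans hT'.2
  set v : ℝ → ℝ := fun u => ∑ j, max (-w j u) 0
  have hv0 : ∀ u, 0 ≤ v u := fun u => Finset.sum_nonneg fun j _ => le_max_right _ _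
  have hvc : ContinuousOn v (Icc s T) :=
    continuousOn_finsetSum _ fun j _ => (hw j).neg.sup continuousOn_const
  have hlv : ∀ {a b}, a ∈ Icc s T → b ∈ Icc s T →
      IntervalIntegrable (fun u => l u * v u) volume a b := fun ha hb =>
    (hl.intervalIntegrable_real _ _).mul_continuousOn (hvc.mono (uIcc_subset_Icc ha hb))
  have hs : s ∈ Icc s T := ⟨le_rfl, hsT⟩
  have hnn : ∀ u, 0 ≤ l u * v u := fun u => mul_nonneg (hl0 u) (hv0 u)
  have step : ∀ i, ∀ t ∈ Icc s T, max (-w i t) 0 ≤ ∫ u in s..t, l u * v u := by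
    intro i t ht
    refine max_le ?_ (intervalIntegral.integral_nonneg ht.1 fun u _ => hnn u)
    have hcpt : IsCompact (Icc s t ∩ (w i) ⁻¹' Ici 0) :=
      isCompact_Icc.of_isClosed_subset (((hw i).mono (Icc_subset_Icc le_rfl ht.2)
        |>.preimage_isClosed_of_isClosed isClosed_Icc isClosed_Ici)) inter_subset_left
    -- `t0` is the last time up to `t` at which `w i` is nonnegative. The lower bound on `φ i` is
    -- available after `t0` only, hence the half-open interval below.
    obtain ⟨t0, ⟨ht0, hwt0⟩, hmax⟩ := hcpt.exists_isGreatest ⟨s, ⟨le_rfl, ht.1⟩, h0 i⟩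
    have ht0T : t0 ∈ Icc s T := ⟨ht0.1, ht0.2.trans ht.2⟩
    have hφi : ∀ {a b}, a ∈ Icc s T → b ∈ Icc s T → IntervalIntegrable (φ i) volume a b :=
      fun ha hb => (hφ i).mono_set (by rw [uIcc_of_le hsT]; exact uIcc_subset_Icc ha hb)
    have e : w i t = w i t0 + ∫ u in t0..t, φ i u := by
      rw [heq i t ht, heq i t0 ht0T, add_assoc,
        intervalIntegral.integral_add_adjacent_intervals (hφi hs ht0T) (hφi ht0T ht)]
    have e1 : -∫ u in t0..t, l u * v u ≤ ∫ u in t0..t, φ i u := by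
      rw [← intervalIntegral.integral_neg]
      refine intervalIntegral.integral_mono_ae_restrict ht0.2 (hlv ht0T ht).neg (hφi ht0T ht) ?_
      rw [restrict_Ioc_eq_restrict_Icc.symm]
      refine (ae_restrict_iff' measurableSet_Ioc).2 ?_
      filter_upwards [h] with u hu hut
      refine hu ⟨ht0.1.trans hut.1.le, hut.2.trans ht.2⟩ i ?_
      by_contra hpos
      exact absurd (hmax ⟨⟨ht0.1.trans hut.1.le, hut.2⟩, (not_le.1 hpos).le⟩) (not_le.2 hut.1)
    have e2 : ∫ u in s..t, l u * v u =
        (∫ u in s..t0, l u * v u) + ∫ u in t0..t, l u * v u :=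
      (intervalIntegral.integral_add_adjacent_intervals (hlv hs ht0T) (hlv ht0T ht)).symm
    have e3 : 0 ≤ ∫ u in s..t0, l u * v u :=
      intervalIntegral.integral_nonneg ht0.1 fun u _ => hnn u
    have : 0 ≤ w i t0 := hwt0
    linarith
  have hG := le_mul_exp_integral_of_le_add_integral (l := fun u => N * l u) (v := v) (c := 0) hsT
    ((hl.intervalIntegrable_real s T).const_mul _)
    (fun t => mul_nonneg (Nat.cast_nonneg _) (hl0 t)) hvc (fun t ht => by
      calc v t ≤ ∑ _j : Fin N, ∫ u in s..t, l u * v u :=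
            Finset.sum_le_sum fun j _ => step j t ht
        _ = 0 + ∫ u in s..t, N * l u * v u := by
            simp only [mul_assoc, intervalIntegral.integral_const_mul]
            simp)
  intro i
  have h1 := hG T' hT'
  rw [zero_mul] at h1
  have h2 : max (-w i T') 0 ≤ v T' :=
    Finset.single_le_sum (f := fun j => max (-w j T') 0) (fun j _ => le_max_right _ _)
      (Finset.mem_univ i)
  linarith [le_max_left (-w i T') 0]

variable {N : ℕ} {f : ℝ → E N → E N}

theorem IsLC.ae_continuous (hf : IsLC f) : ∀ᵐ t, Continuous (f t) := by
  choose l _ hl using fun n : ℕ => hf.lBound _ (isCompact_closedBall (0 : E N) n)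
  filter_upwards [ae_all_iff.2 hl] with t ht
  refine continuous_iff_continuousAt.2 fun x => ?_
  obtain ⟨n, hn⟩ := exists_nat_gt ‖x‖
  have hL : LipschitzOnWith (l n t).toNNReal (f t) (Metric.closedBall 0 n) :=
    LipschitzOnWith.of_dist_le_mul fun y hy z hz => by
      rw [dist_eq_norm, dist_eq_norm]
      exact (ht n y hy z hz).trans
        (mul_le_mul_of_nonneg_right (Real.le_coe_toNNReal _) (norm_nonneg _))
  refine hL.continuousOn.continuousAt (mem_of_superset (Metric.isOpen_ball.mem_nhds ?_)
    Metric.ball_subset_closedBall)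
  simpa using hn

/-- The exceptional null set in the hypothesis depends on `x`. A countable dense subset of each
face, with continuity of `f t`, gives one null set for all `x`. -/
theorem CondA1.ae_nonneg (hf : IsLC f) (h : CondA1 f) :
    ∀ᵐ t, ∀ (x : E N) (i : Fin N), (∀ j, 0 ≤ x j) → x i = 0 → 0 ≤ f t x i := by
  have key : ∀ i : Fin N, ∀ᵐ t, ∀ x : {x : E N // (∀ j, 0 ≤ x j) ∧ x i = 0}, 0 ≤ f t x i := by
    intro i
    obtain ⟨D, hDc, hD⟩ :=
      TopologicalSpace.exists_countable_dense {x : E N // (∀ j, 0 ≤ x j) ∧ x i = 0}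
    have h1 : ∀ᵐ t, ∀ x ∈ D, 0 ≤ f t x i :=
      (ae_ball_iff hDc).2 fun x _ => h x i x.2.1 x.2.2
    filter_upwards [h1, hf.ae_continuous] with t ht hc x
    have hcl : IsClosed {x : {x : E N // (∀ j, 0 ≤ x j) ∧ x i = 0} | 0 ≤ f t x i} :=
      isClosed_le continuous_const (by fun_prop)
    exact hcl.closure_subset_iff.2 ht (hD x)
  filter_upwards [ae_all_iff.2 key] with t ht x i hx hxi
  exact ht i ⟨x, hx, hxi⟩

/-- Fubini gives the inequality for almost every `x`, hence on a dense set. Continuity extends it to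
the open cone, and shifting `x` by `ε (1, …, 1)` reaches the boundary, which is itself null. -/
theorem CondA2.ae_le {A : ℝ → Matrix (Fin N) (Fin N) ℝ} {b : ℝ → E N} (hf : IsLC f)
    (h : CondA2 f A b) :
    ∀ᵐ t, ∀ x : E N, (∀ j, 0 ≤ x j) → ∀ i, f t x i ≤ (∑ j, A t i j * x j) + b t i := by
  filter_upwards [Measure.ae_ae_of_ae_prod h.le, hf.ae_continuous] with t ht hc x hx i
  have hd := Measure.dense_of_ae ht
  set O : Set (E N) := {y | ∀ j, 0 < y j}
  have hO : IsOpen O := by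
    simp only [O, ofPred_forall]
    exact isOpen_iInter_of_finite fun j => isOpen_lt continuous_const (by fun_prop)
  have hcl : IsClosed {y : E N | f t y i ≤ (∑ j, A t i j * y j) + b t i} :=
    isClosed_le (by fun_prop) (by fun_prop)
  have hsub : O ⊆ {y : E N | f t y i ≤ (∑ j, A t i j * y j) + b t i} :=
    (hd.open_subset_closure_inter hO).trans
      (hcl.closure_subset_iff.2 fun y hy => hy.2 (fun j => (hy.1 j).le) i)
  have hlim : Tendsto (fun ε : ℝ => x + ε • WithLp.toLp 2 (fun _ : Fin N => (1 : ℝ)))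
      (𝓝[>] 0) (𝓝 x) := by
    have : Continuous (fun ε : ℝ => x + ε • WithLp.toLp 2 (fun _ : Fin N => (1 : ℝ))) := by
      fun_prop
    simpa using (this.tendsto 0).mono_left nhdsWithin_le_nhds
  refine hcl.mem_of_tendsto hlim ?_
  filter_upwards [self_mem_nhdsWithin] with ε hε
  refine hsub fun j => ?_
  have : 0 < ε := hε
  simpa using add_pos_of_nonneg_of_pos (hx j) this

end Nonneg

/-! ### Solutions in the cone -/

section Solutions

open Set

variable {N : ℕ} {f : ℝ → E N → E N} {A : ℝ → Matrix (Fin N) (Fin N) ℝ} {b : ℝ → E N}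

/-- Used to see that the clamp is nonexpansive and to turn componentwise comparison into a norm
bound. -/
theorem norm_le_norm_of_abs_le {x y : E N} (h : ∀ i, |x i| ≤ |y i|) : ‖x‖ ≤ ‖y‖ := by
  rw [EuclideanSpace.norm_eq, EuclideanSpace.norm_eq]
  refine Real.sqrt_le_sqrt (Finset.sum_le_sum fun i _ => ?_)
  simp only [Real.norm_eq_abs]
  exact pow_le_pow_left₀ (abs_nonneg _) (h i) 2

theorem intervalIntegrable_coord {φ : ℝ → E N} {a c : ℝ} (h : IntervalIntegrable φ volume a c)
    (i : Fin N) : IntervalIntegrable (fun u => φ u i) volume a c :=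
  ⟨(EuclideanSpace.proj (𝕜 := ℝ) i).integrable_comp h.1,
    (EuclideanSpace.proj (𝕜 := ℝ) i).integrable_comp h.2⟩

theorem intervalIntegral_coord {φ : ℝ → E N} {a c : ℝ} (h : IntervalIntegrable φ volume a c)
    (i : Fin N) : (∫ u in a..c, φ u) i = ∫ u in a..c, φ u i :=
  ((EuclideanSpace.proj (𝕜 := ℝ) i).intervalIntegral_comp_comm h).symm

theorem _root_.MeasureTheory.LocallyIntegrable.coord {φ : ℝ → E N}
    (h : LocallyIntegrable φ volume) (i : Fin N) : LocallyIntegrable (fun u => φ u i) volume := by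
  intro x
  obtain ⟨U, hU, hi⟩ := h x
  exact ⟨U, hU, (EuclideanSpace.proj (𝕜 := ℝ) i).integrable_comp hi⟩

theorem _root_.MeasureTheory.LocallyIntegrable.norm_real {F : Type*} [NormedAddCommGroup F]
    {φ : ℝ → F} (h : LocallyIntegrable φ volume) : LocallyIntegrable (fun u => ‖φ u‖) volume := by
  intro x
  obtain ⟨U, hU, hi⟩ := h x
  exact ⟨U, hU, hi.norm⟩

namespace IsSolutionOn

variable {s T : ℝ} {x₀ : E N} {x : ℝ → E N}

theorem apply_left {J : Set ℝ} (h : IsSolutionOn f s x₀ J x) (hs : s ∈ J) : x s = x₀ := by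
  simpa using h.eqn s hs

theorem mono {J J' : Set ℝ} (h : IsSolutionOn f s x₀ J x) (hJ : J' ⊆ J) :
    IsSolutionOn f s x₀ J' x :=
  ⟨h.cont.mono hJ, fun t ht => h.integrable t (hJ ht), fun t ht => h.eqn t (hJ ht)⟩

theorem intervalIntegrable {J : Set ℝ} (h : IsSolutionOn f s x₀ J x) {r t : ℝ} (hr : r ∈ J)
    (ht : t ∈ J) : IntervalIntegrable (fun u => f u (x u)) volume r t :=
  (h.integrable r hr).symm.trans (h.integrable t ht)

theorem sub_eq {J : Set ℝ} (h : IsSolutionOn f s x₀ J x) {r t : ℝ} (hr : r ∈ J) (ht : t ∈ J) :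
    x t = x r + ∫ u in r..t, f u (x u) := by
  rw [h.eqn t ht, h.eqn r hr, add_assoc, intervalIntegral.integral_add_adjacent_intervals
    (h.integrable r hr) (h.intervalIntegrable hr ht)]

theorem restart {J : Set ℝ} (h : IsSolutionOn f s x₀ J x) {r : ℝ} (hr : r ∈ J) {J' : Set ℝ}
    (hJ : J' ⊆ J) : IsSolutionOn f r (x r) J' x :=
  ⟨h.cont.mono hJ, fun _ ht => h.intervalIntegrable hr (hJ ht), fun _ ht => h.sub_eq hr (hJ ht)⟩

theorem coord_eq {J : Set ℝ} (h : IsSolutionOn f s x₀ J x) {t : ℝ} (ht : t ∈ J) (i : Fin N) :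
    x t i = x₀ i + ∫ u in s..t, f u (x u) i := by
  rw [← intervalIntegral_coord (h.integrable t ht), h.eqn t ht]
  rfl

theorem continuousOn_coord {J : Set ℝ} (h : IsSolutionOn f s x₀ J x) (i : Fin N) :
    ContinuousOn (fun t => x t i) J :=
  (EuclideanSpace.proj (𝕜 := ℝ) i).continuous.comp_continuousOn h.cont

theorem norm_sub_le {K : Set (E N)} {m : ℝ → ℝ} (hm : LocallyIntegrable m volume)
    (hK : ∀ᵐ t, ∀ x ∈ K, ‖f t x‖ ≤ m t)
    (h : IsSolutionOn f s x₀ (Icc s T) x) (hx : ∀ t ∈ Icc s T, x t ∈ K) :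
    ∀ t ∈ Icc s T, ‖x t - x₀‖ ≤ ∫ u in s..t, m u := by
  intro t ht
  rw [h.eqn t ht, add_sub_cancel_left]
  refine intervalIntegral.norm_integral_le_of_norm_le ht.1 ?_ (hm.intervalIntegrable_real s t)
  filter_upwards [hK] with u hu hut
  exact hu _ (hx u ⟨hut.1.le, hut.2.trans ht.2⟩)

theorem norm_sub_le_mul_exp {K : Set (E N)} {l : ℝ → ℝ} (hl : LocallyIntegrable l volume)
    (hl0 : ∀ t, 0 ≤ l t) (hK : ∀ᵐ t, ∀ x ∈ K, ∀ y ∈ K, ‖f t x - f t y‖ ≤ l t * ‖x - y‖)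
    {y₀ : E N} {y : ℝ → E N} (h : IsSolutionOn f s x₀ (Icc s T) x)
    (h' : IsSolutionOn f s y₀ (Icc s T) y) (hx : ∀ t ∈ Icc s T, x t ∈ K)
    (hy : ∀ t ∈ Icc s T, y t ∈ K) :
    ∀ t ∈ Icc s T, ‖x t - y t‖ ≤ ‖x₀ - y₀‖ * Real.exp (∫ u in s..t, l u) := by
  intro T' hT'
  refine le_mul_exp_integral_of_le_add_integral (v := fun t => ‖x t - y t‖)
    (hT'.1.trans hT'.2) (hl.intervalIntegrable_real s T) hl0 (h.cont.sub h'.cont).norm ?_ T' hT'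
  intro t ht
  have e : x t - y t = (x₀ - y₀) + ∫ u in s..t, (f u (x u) - f u (y u)) := by
    rw [intervalIntegral.integral_sub (h.integrable t ht) (h'.integrable t ht), h.eqn t ht,
      h'.eqn t ht]
    abel
  change ‖x t - y t‖ ≤ _
  rw [e]
  refine (norm_add_le _ _).trans (add_le_add le_rfl ?_)
  have hsub : uIcc s t ⊆ Icc s T := by
    rw [uIcc_of_le ht.1]; exact Icc_subset_Icc le_rfl ht.2
  refine intervalIntegral.norm_integral_le_of_norm_le ht.1 ?_
    ((hl.intervalIntegrable_real s t).mul_continuousOn ((h.cont.sub h'.cont).norm.mono hsub))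
  filter_upwards [hK] with u hu hut
  have hu' : u ∈ Icc s T := ⟨hut.1.le, hut.2.trans ht.2⟩
  exact hu _ (hx u hu') _ (hy u hu')

theorem eq_of_isLC (hf : IsLC f) {y : ℝ → E N} (h : IsSolutionOn f s x₀ (Icc s T) x)
    (h' : IsSolutionOn f s x₀ (Icc s T) y) : ∀ t ∈ Icc s T, x t = y t := by
  intro t ht
  have hcpt : IsCompact (x '' Icc s T ∪ y '' Icc s T) :=
    (isCompact_Icc.image_of_continuousOn h.cont).union (isCompact_Icc.image_of_continuousOn h'.cont)
  obtain ⟨l, hl, hlK⟩ := hf.lBound _ hcpt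
  have := norm_sub_le_mul_exp (l := fun t => |l t|) hl.norm_real (fun t => abs_nonneg _)
    (hlK.mono fun t ht x hx y hy => (ht x hx y hy).trans
      (mul_le_mul_of_nonneg_right (le_abs_self _) (norm_nonneg _))) h h'
    (fun t ht => Or.inl (mem_image_of_mem _ ht)) (fun t ht => Or.inr (mem_image_of_mem _ ht)) t ht
  rw [sub_self, norm_zero, zero_mul] at this
  exact sub_eq_zero.1 (norm_le_zero_iff.1 this)

end IsSolutionOn

/-! ### Truncation to a box, a priori bounds and global existence -/

/-- The points of the cone with all coordinates at most `R`. -/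
def box (N : ℕ) (R : ℝ) : Set (E N) := {x | ∀ i, 0 ≤ x i ∧ x i ≤ R}

theorem isCompact_box (R : ℝ) : IsCompact (box N R) := by
  have h : IsCompact (WithLp.toLp 2 '' (pi univ fun _ : Fin N => Icc (0 : ℝ) R) : Set (E N)) :=
    (isCompact_univ_pi fun _ => isCompact_Icc).image (PiLp.continuous_toLp 2 _)
  refine h.of_isClosed_subset ?_ fun x hx => ⟨fun i => x i, fun i _ => hx i, rfl⟩
  simp only [box, ofPred_forall, ofPred_and]
  exact isClosed_iInter fun i => (isClosed_le continuous_const (by fun_prop)).inter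
    (isClosed_le (by fun_prop) continuous_const)

/-- The retraction of `ℝ^N` onto `box N R`. -/
def clamp (R : ℝ) (x : E N) : E N := WithLp.toLp 2 fun i => max 0 (min (x i) R)

theorem clamp_apply (R : ℝ) (x : E N) (i : Fin N) : clamp R x i = max 0 (min (x i) R) := rfl

theorem clamp_mem_box {R : ℝ} (hR : 0 ≤ R) (x : E N) : clamp R x ∈ box N R :=
  fun _ => ⟨le_max_left _ _, max_le hR (min_le_right _ _)⟩

theorem clamp_of_mem_box {R : ℝ} {x : E N} (hx : x ∈ box N R) : clamp R x = x := by
  ext i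
  rw [clamp_apply, min_eq_left (hx i).2, max_eq_right (hx i).1]

theorem norm_clamp_sub_clamp_le (R : ℝ) (x y : E N) : ‖clamp R x - clamp R y‖ ≤ ‖x - y‖ := by
  refine norm_le_norm_of_abs_le fun i => ?_
  simp only [PiLp.sub_apply, clamp_apply]
  refine (abs_max_sub_max_le_max _ _ _ _).trans (max_le (by simp) ?_)
  exact (abs_min_sub_min_le_max _ _ _ _).trans (by simp)

theorem continuous_clamp (R : ℝ) : Continuous (clamp (N := N) R) :=
  (LipschitzWith.of_dist_le_mul (K := 1) fun x y => by
    simpa [dist_eq_norm] using norm_clamp_sub_clamp_le R x y).continuous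

theorem IsLC.exists_isSolutionOn_clamp (hf : IsLC f) {R : ℝ} (hR : 0 ≤ R) {s T : ℝ} (hsT : s ≤ T)
    (x₀ : E N) : ∃ x : ℝ → E N, IsSolutionOn (fun t x => f t (clamp R x)) s x₀ (Icc s T) x := by
  obtain ⟨l, hl, hlK⟩ := hf.lBound _ (isCompact_box R)
  obtain ⟨m, hm, hmK⟩ := hf.mBound _ (isCompact_box R)
  refine exists_isSolutionOn_of_lipschitz (l := fun t => |l t|) (m := m) ?_ hl.norm_real
    (fun _ => abs_nonneg _) hm ?_ ?_ hsT x₀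
  · exact hf.measurable.comp
      (measurable_fst.prodMk ((continuous_clamp R).measurable.comp measurable_snd))
  · filter_upwards [hmK] with t ht x using ht _ (clamp_mem_box hR x)
  · filter_upwards [hlK] with t ht x y
    refine (ht _ (clamp_mem_box hR x) _ (clamp_mem_box hR y)).trans ?_
    exact mul_le_mul (le_abs_self _) (norm_clamp_sub_clamp_le R x y) (norm_nonneg _)
      (abs_nonneg _)

/-- The sum of the absolute values of the entries of `A t`. -/
def entrySum (A : ℝ → Matrix (Fin N) (Fin N) ℝ) (t : ℝ) : ℝ := ∑ i, ∑ j, |A t i j|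

/-- The sum of the absolute values of the coordinates of `b t`. -/
def coordSum (b : ℝ → E N) (t : ℝ) : ℝ := ∑ i, |b t i|

theorem entrySum_nonneg (A : ℝ → Matrix (Fin N) (Fin N) ℝ) (t : ℝ) : 0 ≤ entrySum A t :=
  Finset.sum_nonneg fun _ _ => Finset.sum_nonneg fun _ _ => abs_nonneg _

theorem coordSum_nonneg (b : ℝ → E N) (t : ℝ) : 0 ≤ coordSum b t :=
  Finset.sum_nonneg fun _ _ => abs_nonneg _

theorem abs_entry_le_entrySum (A : ℝ → Matrix (Fin N) (Fin N) ℝ) (t : ℝ) (i j : Fin N) :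
    |A t i j| ≤ entrySum A t :=
  (Finset.single_le_sum (f := fun j => |A t i j|) (fun _ _ => abs_nonneg _)
    (Finset.mem_univ j)).trans
  (Finset.single_le_sum (f := fun i => ∑ j, |A t i j|)
    (fun _ _ => Finset.sum_nonneg fun _ _ => abs_nonneg _) (Finset.mem_univ i))

theorem CondA2.locallyIntegrable_entrySum (h : CondA2 f A b) :
    LocallyIntegrable (entrySum A) volume :=
  locallyIntegrable_finsetSum _ fun i _ => locallyIntegrable_finsetSum _ fun j _ =>
    (h.locInt_A i j).norm_real

theorem CondA2.locallyIntegrable_coordSum (h : CondA2 f A b) :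
    LocallyIntegrable (coordSum b) volume :=
  locallyIntegrable_finsetSum _ fun i _ => (h.locInt_b.coord i).norm_real

/-- The a priori bound for the sum of the coordinates of nonnegative solutions on `[s, T]`. -/
def aprioriBound (A : ℝ → Matrix (Fin N) (Fin N) ℝ) (b : ℝ → E N) (s T V : ℝ) : ℝ :=
  (V + ∫ u in s..T, coordSum b u) * Real.exp (∫ u in s..T, entrySum A u)

theorem CondA2.aprioriBound_mono (h : CondA2 f A b) {s T s' T' V V' : ℝ} (hV : 0 ≤ V)
    (hVV : V ≤ V') (hs : s' ≤ s) (hsT : s ≤ T) (hT : T ≤ T') :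
    aprioriBound A b s T V ≤ aprioriBound A b s' T' V' := by
  have key : ∀ g : ℝ → ℝ, LocallyIntegrable g volume → (∀ t, 0 ≤ g t) →
      ∫ u in s..T, g u ≤ ∫ u in s'..T', g u := fun g hg hg0 =>
    intervalIntegral.integral_mono_interval hs hsT hT
      (Eventually.of_forall hg0) (hg.intervalIntegrable_real _ _)
  have h1 := key _ h.locallyIntegrable_coordSum (coordSum_nonneg b)
  have h2 := key _ h.locallyIntegrable_entrySum (entrySum_nonneg A)
  have h3 : 0 ≤ ∫ u in s..T, coordSum b u :=
    intervalIntegral.integral_nonneg hsT fun u _ => coordSum_nonneg b u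
  unfold aprioriBound
  gcongr
  linarith

/-- Gronwall for the sum of the coordinates. The field `g` is left free so that the bound covers
both `f` and its truncations. -/
theorem CondA2.sum_le_aprioriBound (h : CondA2 f A b) {g : ℝ → E N → E N} {s T : ℝ} {x₀ : E N}
    {x : ℝ → E N} (hx : IsSolutionOn g s x₀ (Icc s T) x)
    (hx0 : ∀ t ∈ Icc s T, ∀ i, 0 ≤ x t i)
    (hg : ∀ᵐ t, t ∈ Icc s T → ∀ i, g t (x t) i ≤ ∑ j, |A t i j| * x t j + |b t i|) :
    ∀ t ∈ Icc s T, ∑ i, x t i ≤ aprioriBound A b s T (∑ i, x₀ i) := by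
  intro T' hT'
  have hsT := hT'.1.trans hT'.2
  have ha := h.locallyIntegrable_entrySum
  have hb := h.locallyIntegrable_coordSum
  have hbn : 0 ≤ ∫ u in s..T, coordSum b u :=
    intervalIntegral.integral_nonneg hsT fun u _ => coordSum_nonneg b u
  have hvc : ContinuousOn (fun t => ∑ i, x t i) (Icc s T) :=
    continuousOn_finsetSum _ fun i _ => hx.continuousOn_coord i
  have hG := le_mul_exp_integral_of_le_add_integral (v := fun t => ∑ i, x t i)
    (c := ∑ i, x₀ i + ∫ u in s..T, coordSum b u) hsT (ha.intervalIntegrable_real s T)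
    (entrySum_nonneg A) hvc (fun t ht => by
      have hsub : uIcc s t ⊆ Icc s T := by
        rw [uIcc_of_le ht.1]; exact Icc_subset_Icc le_rfl ht.2
      have hav : IntervalIntegrable (fun u => entrySum A u * ∑ i, x u i) volume s t :=
        (ha.intervalIntegrable_real s t).mul_continuousOn (hvc.mono hsub)
      have e : ∑ i, x t i = ∑ i, x₀ i + ∫ u in s..t, ∑ i, g u (x u) i := by
        rw [intervalIntegral.integral_finsetSum fun i _ =>
          intervalIntegrable_coord (hx.integrable t ht) i, ← Finset.sum_add_distrib]
        exact Finset.sum_congr rfl fun i _ => hx.coord_eq ht i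
      have e1 : ∫ u in s..t, ∑ i, g u (x u) i ≤
          ∫ u in s..t, (coordSum b u + entrySum A u * ∑ i, x u i) := by
        refine intervalIntegral.integral_mono_ae_restrict ht.1 ?_
          ((hb.intervalIntegrable_real s t).add hav) ?_
        · have hi := fun i => intervalIntegrable_coord (hx.integrable t ht) i
          exact ⟨integrable_finsetSum _ fun i _ => (hi i).1,
            integrable_finsetSum _ fun i _ => (hi i).2⟩
        · refine (ae_restrict_iff' measurableSet_Icc).2 ?_
          filter_upwards [hg] with u hu hut
          have hu' : u ∈ Icc s T := ⟨hut.1, hut.2.trans ht.2⟩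
          calc ∑ i, g u (x u) i ≤ ∑ i, (∑ j, |A u i j| * x u j + |b u i|) :=
                Finset.sum_le_sum fun i _ => hu hu' i
            _ ≤ ∑ i, (∑ j, |A u i j| * ∑ k, x u k + |b u i|) := by
                gcongr with i _ j _
                exact Finset.single_le_sum (f := fun k => x u k) (fun k _ => hx0 u hu' k)
                  (Finset.mem_univ j)
            _ = coordSum b u + entrySum A u * ∑ i, x u i := by
                simp only [Finset.sum_add_distrib, ← Finset.sum_mul, coordSum, entrySum]
                ring
      rw [intervalIntegral.integral_add (hb.intervalIntegrable_real s t) hav] at e1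
      have e2 : ∫ u in s..t, coordSum b u ≤ ∫ u in s..T, coordSum b u :=
        intervalIntegral.integral_mono_interval le_rfl ht.1 ht.2
          (Eventually.of_forall (coordSum_nonneg b)) (hb.intervalIntegrable_real _ _)
      change ∑ i, x t i ≤ _
      rw [e]
      linarith) T' hT'
  have hV : 0 ≤ ∑ i, x₀ i := by
    have := hx.apply_left ⟨le_rfl, hsT⟩
    rw [← this]
    exact Finset.sum_nonneg fun i _ => hx0 s ⟨le_rfl, hsT⟩ i
  refine hG.trans ?_
  unfold aprioriBound
  have : ∫ u in s..T', entrySum A u ≤ ∫ u in s..T, entrySum A u :=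
    intervalIntegral.integral_mono_interval le_rfl hT'.1 hT'.2
      (Eventually.of_forall (entrySum_nonneg A)) (ha.intervalIntegrable_real _ _)
  gcongr

/-- The second point `y` is there for truncation: `x` will be the clamped value of the solution and
`y` the solution itself. -/
theorem CondA2.ae_le_abs (hf : IsLC f) (h : CondA2 f A b) :
    ∀ᵐ t, ∀ x y : E N, (∀ j, 0 ≤ x j ∧ x j ≤ y j) →
      ∀ i, f t x i ≤ ∑ j, |A t i j| * y j + |b t i| := by
  filter_upwards [h.ae_le hf] with t ht x y hxy i
  refine (ht x (fun j => (hxy j).1) i).trans ?_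
  gcongr with j
  · exact (hxy j).1
  · exact le_abs_self _
  · exact (hxy j).2
  · exact le_abs_self _

theorem exists_nonneg_isSolutionOn_Icc (hf : IsLC f) (hA1 : CondA1 f) (hA2 : CondA2 f A b)
    {s T : ℝ} (hsT : s ≤ T) {x₀ : E N} (hx₀ : ∀ i, 0 ≤ x₀ i) :
    ∃ x : ℝ → E N, IsSolutionOn f s x₀ (Icc s T) x ∧ ∀ t ∈ Icc s T, ∀ i, 0 ≤ x t i := by
  -- The a priori bound does not depend on the truncation level, so it can be chosen as that level;
  -- the clamp then fixes the solution.
  set R := aprioriBound A b s T (∑ i, x₀ i)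
  have hR : 0 ≤ R := by
    have h1 : 0 ≤ ∑ i, x₀ i := Finset.sum_nonneg fun i _ => hx₀ i
    have h2 : 0 ≤ ∫ u in s..T, coordSum b u :=
      intervalIntegral.integral_nonneg hsT fun u _ => coordSum_nonneg b u
    exact mul_nonneg (add_nonneg h1 h2) (Real.exp_pos _).le
  have hs : s ∈ Icc s T := ⟨le_rfl, hsT⟩
  obtain ⟨x, hx⟩ := hf.exists_isSolutionOn_clamp hR hsT x₀
  have hnn : ∀ t ∈ Icc s T, ∀ i, 0 ≤ x t i := by
    refine nonneg_of_integral_of_quasipositive (w := fun i t => x t i)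
      (φ := fun i u => f u (clamp R (x u)) i) (l := fun _ => 0) locallyIntegrable_zero
      (fun _ => le_rfl) hx.continuousOn_coord
      (fun i => intervalIntegrable_coord (hx.integrable T ⟨hsT, le_rfl⟩) i)
      (fun i t ht => ?_) (fun i => ?_) ?_
    · rw [hx.apply_left hs]
      exact hx.coord_eq ht i
    · rw [hx.apply_left hs]
      exact hx₀ i
    -- Where `x i ≤ 0`, the clamped point lies on the face with vanishing `i`-th coordinate, so the
    -- field there points inward.
    · filter_upwards [hA1.ae_nonneg hf] with u hu _ i hi
      rw [zero_mul, neg_zero]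
      refine hu _ i (fun j => le_max_left _ _) ?_
      rw [clamp_apply]
      exact max_eq_left ((min_le_left _ _).trans hi)
  have hbd := hA2.sum_le_aprioriBound hx hnn (by
    filter_upwards [hA2.ae_le_abs hf] with u hu hus i
    refine hu _ _ (fun j => ⟨le_max_left _ _, ?_⟩) i
    exact max_le (hnn u hus j) (min_le_left _ _))
  have hbox : ∀ t ∈ Icc s T, clamp R (x t) = x t := fun t ht =>
    clamp_of_mem_box fun i => ⟨hnn t ht i, (Finset.single_le_sum (f := fun i => x t i)
      (fun j _ => hnn t ht j) (Finset.mem_univ i)).trans (hbd t ht)⟩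
  have hfx : ∀ t ∈ Icc s T, EqOn (fun u => f u (clamp R (x u))) (fun u => f u (x u)) (uIcc s t) :=
    fun t ht u hu => by
      rw [uIcc_of_le ht.1] at hu
      change f u _ = f u _
      rw [hbox u ⟨hu.1, hu.2.trans ht.2⟩]
  refine ⟨x, ⟨hx.cont, fun t ht => ?_, fun t ht => ?_⟩, hnn⟩
  · exact (hx.integrable t ht).congr ((hfx t ht).mono uIoc_subset_uIcc)
  · rw [hx.eqn t ht, intervalIntegral.integral_congr (hfx t ht)]

/-- By uniqueness the solutions on the intervals `[s, T]` agree where they overlap, so the diagonal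
`t ↦ y t t` glues them. -/
theorem exists_nonneg_isSolutionOn_Ici (hf : IsLC f) (hA1 : CondA1 f) (hA2 : CondA2 f A b)
    (s : ℝ) {x₀ : E N} (hx₀ : ∀ i, 0 ≤ x₀ i) :
    ∃ x : ℝ → E N, IsSolutionOn f s x₀ (Ici s) x ∧ ∀ t ∈ Ici s, ∀ i, 0 ≤ x t i := by
  choose! y hy hy0 using fun (T : ℝ) (hT : s ≤ T) =>
    exists_nonneg_isSolutionOn_Icc hf hA1 hA2 hT hx₀
  have hEq : ∀ T, s ≤ T → EqOn (y T) (fun t => y t t) (Icc s T) := fun T hT t ht =>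
    ((hy T hT).mono (Icc_subset_Icc le_rfl ht.2)).eq_of_isLC hf (hy t ht.1) t ⟨ht.1, le_rfl⟩
  have hfEq : ∀ T, s ≤ T → EqOn (fun u => f u (y T u)) (fun u => f u (y u u)) (uIcc s T) :=
    fun T hT u hu => by
      rw [uIcc_of_le hT] at hu
      exact congrArg (f u) (hEq T hT hu)
  refine ⟨fun t => y t t, ⟨fun t ht => ?_, fun t ht => ?_, fun t ht => ?_⟩,
    fun t ht => hy0 t ht t ⟨ht, le_rfl⟩⟩
  · have ht' : s ≤ t + 1 := (show s ≤ t from ht).trans (by linarith)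
    have h1 : ContinuousOn (fun t => y t t) (Icc s (t + 1)) :=
      ((hy _ ht').cont).congr fun u hu => (hEq _ ht' hu).symm
    refine (h1 t ⟨ht, by linarith⟩).mono_of_mem_nhdsWithin ?_
    exact mem_of_superset (inter_mem_nhdsWithin _ (Iic_mem_nhds (lt_add_one t)))
      fun u hu => ⟨hu.1, hu.2⟩
  · exact ((hy t ht).integrable t ⟨ht, le_rfl⟩).congr ((hfEq t ht).mono uIoc_subset_uIcc)
  · rw [← intervalIntegral.integral_congr (hfEq t ht)]
    exact (hy t ht).eqn t ⟨ht, le_rfl⟩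

end Solutions

/-! ### The induced process -/

section InducedProcess

open Set

variable {N : ℕ} {f : ℝ → E N → E N} {A : ℝ → Matrix (Fin N) (Fin N) ℝ} {b : ℝ → E N}

/-- The box depends only on `a`, `c` and `V`, so all solutions with nearby data share the same
bounding and Lipschitz weights. -/
theorem mem_box_of_isSolutionOn (hf : IsLC f) (hA2 : CondA2 f A b) {s T a c V : ℝ} {x₀ : E N}
    {x : ℝ → E N} (hx : IsSolutionOn f s x₀ (Icc s T) x) (hx0 : ∀ t ∈ Icc s T, ∀ i, 0 ≤ x t i)
    (has : a ≤ s) (hTc : T ≤ c) (hV : ∑ i, x₀ i ≤ V) :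
    ∀ t ∈ Icc s T, x t ∈ box N (aprioriBound A b a c V) := by
  intro t ht i
  have hsT := ht.1.trans ht.2
  have hV0 : 0 ≤ ∑ i, x₀ i := by
    rw [← hx.apply_left ⟨le_rfl, hsT⟩]
    exact Finset.sum_nonneg fun i _ => hx0 s ⟨le_rfl, hsT⟩ i
  refine ⟨hx0 t ht i, (Finset.single_le_sum (f := fun i => x t i) (fun j _ => hx0 t ht j)
    (Finset.mem_univ i)).trans ((hA2.sum_le_aprioriBound hx hx0 ?_ t ht).trans
      (hA2.aprioriBound_mono hV0 hV has hsT hTc))⟩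
  filter_upwards [hA2.ae_le_abs hf] with u hu hus i
  exact hu _ _ (fun j => ⟨hx0 u hus j, le_rfl⟩) i

/-- Continuous dependence on the starting time and the starting point. -/
theorem norm_sub_le_of_le_start {S : ℝ → ℝ → Cone N → Cone N}
    (hcomp : ∀ (s r t : ℝ), s ≤ r → r ≤ t → ∀ x, S t s x = S t r (S r s x))
    (hsol : ∀ (s : ℝ) (x₀ : Cone N),
      IsSolutionOn f s (x₀ : E N) (Ici s) (fun t => (S t s x₀ : E N)))
    {K : Set (E N)} {m l : ℝ → ℝ} (hm : LocallyIntegrable m volume)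
    (hm0 : ∀ t, 0 ≤ m t) (hmK : ∀ᵐ t, ∀ x ∈ K, ‖f t x‖ ≤ m t)
    (hl : LocallyIntegrable l volume) (hl0 : ∀ t, 0 ≤ l t)
    (hlK : ∀ᵐ t, ∀ x ∈ K, ∀ y ∈ K, ‖f t x - f t y‖ ≤ l t * ‖x - y‖)
    {a c s s' t : ℝ} {x x' : Cone N} (has : a ≤ s) (hss : s ≤ s') (hsc : s' ≤ c) (htc : t ≤ c)
    (hx : ∀ u ∈ Icc s c, (S u s x : E N) ∈ K) (hx' : ∀ u ∈ Icc s' c, (S u s' x' : E N) ∈ K) :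
    ‖(S (max t s) s x : E N) - S (max t s') s' x'‖ ≤
      (‖(x : E N) - x'‖ + ∫ u in s..s', m u) * Real.exp (∫ u in a..c, l u) := by
  have hself : ∀ s x, (S s s x : E N) = x := fun s x => (hsol s x).apply_left self_mem_Ici
  have hm' : 0 ≤ ∫ u in s..s', m u := intervalIntegral.integral_nonneg hss fun u _ => hm0 u
  have hle : 0 ≤ ∫ u in a..c, l u :=
    intervalIntegral.integral_nonneg ((has.trans hss).trans hsc) fun u _ => hl0 u
  have hstart : ∀ r ∈ Icc s s', ‖(S r s x : E N) - x‖ ≤ ∫ u in s..s', m u := fun r hr =>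
    (((hsol s x).mono Icc_subset_Ici_self).norm_sub_le (T := s') hm hmK
      (fun u hu => hx u ⟨hu.1, hu.2.trans hsc⟩) r hr).trans
      (intervalIntegral.integral_mono_interval le_rfl hr.1 hr.2 (Eventually.of_forall hm0)
        (hm.intervalIntegrable_real _ _))
  rcases le_total s' t with h | h
  · rw [max_eq_left h, max_eq_left (hss.trans h), hcomp s s' t hss h x]
    have h1 := ((hsol s' (S s' s x)).mono Icc_subset_Ici_self).norm_sub_le_mul_exp (T := c) hl hl0
      hlK ((hsol s' x').mono Icc_subset_Ici_self)
      (fun u hu => by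
        rw [← hcomp s s' u hss hu.1 x]
        exact hx u ⟨hss.trans hu.1, hu.2⟩) hx' t ⟨h, htc⟩
    refine h1.trans (mul_le_mul ?_ (Real.exp_le_exp.2 ?_) (Real.exp_pos _).le (by positivity))
    · calc ‖(S s' s x : E N) - x'‖ = ‖((x : E N) - x') + (S s' s x - x)‖ := by congr 1; abel
        _ ≤ _ := (norm_add_le _ _).trans (add_le_add le_rfl (hstart s' ⟨hss, le_rfl⟩))
    · exact intervalIntegral.integral_mono_interval (has.trans hss) h htc
        (Eventually.of_forall hl0) (hl.intervalIntegrable_real _ _)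
  · rw [max_eq_right h, hself]
    calc ‖(S (max t s) s x : E N) - x'‖ = ‖((x : E N) - x') + (S (max t s) s x - x)‖ := by
          congr 1; abel
      _ ≤ ‖(x : E N) - x'‖ + ∫ u in s..s', m u := (norm_add_le _ _).trans
          (add_le_add le_rfl (hstart _ ⟨le_max_right _ _, max_le h hss⟩))
      _ ≤ _ := le_mul_of_one_le_right (by positivity) (Real.one_le_exp hle)

theorem isProcess_of_isSolutionOn (hf : IsLC f) (hA2 : CondA2 f A b)
    {S : ℝ → ℝ → Cone N → Cone N}
    (hsol : ∀ (s : ℝ) (x₀ : Cone N),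
      IsSolutionOn f s (x₀ : E N) (Ici s) (fun t => (S t s x₀ : E N))) : IsProcess S := by
  have hcomp : ∀ (s r t : ℝ), s ≤ r → r ≤ t → ∀ x, S t s x = S t r (S r s x) := by
    intro s r t hsr hrt x
    have h1 := (hsol s x).restart (r := r) hsr (J' := Icc r t)
      fun u hu => hsr.trans hu.1
    exact Subtype.ext (h1.eq_of_isLC hf ((hsol r (S r s x)).mono Icc_subset_Ici_self) t
      ⟨hrt, le_rfl⟩)
  refine ⟨fun t x => Subtype.ext ((hsol t x).apply_left self_mem_Ici), hcomp, ?_⟩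
  rintro ⟨t₀, s₀, x₀⟩ hst₀
  replace hst₀ : s₀ ≤ t₀ := hst₀
  set a := s₀ - 1
  set c := t₀ + 1
  set V := N * (‖(x₀ : E N)‖ + 1)
  set K := box N (aprioriBound A b a c V)
  obtain ⟨m', hm', hmK'⟩ := hf.mBound K (isCompact_box _)
  obtain ⟨l', hl', hlK'⟩ := hf.lBound K (isCompact_box _)
  set m := fun t => ‖m' t‖
  set l := fun t => ‖l' t‖
  have hm : LocallyIntegrable m volume := hm'.norm_real
  have hl : LocallyIntegrable l volume := hl'.norm_real
  have hmK : ∀ᵐ t, ∀ x ∈ K, ‖f t x‖ ≤ m t :=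
    hmK'.mono fun t ht x hx => (ht x hx).trans (le_abs_self _)
  have hlK : ∀ᵐ t, ∀ x ∈ K, ∀ y ∈ K, ‖f t x - f t y‖ ≤ l t * ‖x - y‖ :=
    hlK'.mono fun t ht x hx y hy => (ht x hx y hy).trans
      (mul_le_mul_of_nonneg_right (le_abs_self _) (norm_nonneg _))
  have hbox : ∀ (s : ℝ) (x : Cone N), a ≤ s → ‖(x : E N) - x₀‖ ≤ 1 →
      ∀ u ∈ Icc s c, (S u s x : E N) ∈ K := by
    intro s x has hx
    refine mem_box_of_isSolutionOn hf hA2 ((hsol s x).mono Icc_subset_Ici_self)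
      (fun t _ => (S t s x).2) has le_rfl ?_
    have hxn : ‖(x : E N)‖ ≤ ‖(x₀ : E N)‖ + 1 := by
      have := norm_add_le ((x : E N) - x₀) x₀
      rw [sub_add_cancel] at this
      linarith
    calc ∑ i, (x : E N) i ≤ ∑ _i : Fin N, (‖(x₀ : E N)‖ + 1) :=
          Finset.sum_le_sum fun i _ =>
            ((le_abs_self _).trans (PiLp.norm_apply_le (x : E N) i)).trans hxn
      _ = V := by simp [V, mul_add]
  set L := ∫ u in a..c, l u
  -- A continuous majorant of the distance, vanishing at the base point: changing the starting data
  -- costs the first term, moving along the reference solution the second. Taking `max p.1 s₀` keeps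
  -- the latter solution within its domain when `p.1 < s₀`.
  set F : ℝ × ℝ × Cone N → ℝ := fun p =>
    (‖(p.2.2 : E N) - x₀‖ + |∫ u in p.2.1..s₀, m u|) * Real.exp L +
      ‖(S (max p.1 s₀) s₀ x₀ : E N) - S t₀ s₀ x₀‖
  have hF : Continuous F := by
    have h1 : Continuous fun r : ℝ => ∫ u in r..s₀, m u := by
      simp only [fun r => intervalIntegral.integral_symm (μ := volume) (f := m) s₀ r]
      exact (intervalIntegral.continuous_primitive
        (fun a b => hm.intervalIntegrable_real a b) s₀).neg
    have h2 : Continuous fun r : ℝ => (S (max r s₀) s₀ x₀ : E N) :=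
      (hsol s₀ x₀).cont.comp_continuous (f := fun r => max r s₀) (by fun_prop)
        fun r => mem_Ici.2 (le_max_right _ _)
    have h3 := h1.comp (continuous_fst.comp (continuous_snd (X := ℝ) (Y := ℝ × Cone N)))
    have h4 := h2.comp (continuous_fst (X := ℝ) (Y := ℝ × Cone N))
    simp only [Function.comp_def] at h3 h4
    fun_prop
  have hF0 : F (t₀, s₀, x₀) = 0 := by simp [F, max_eq_left hst₀]
  have hlim : Tendsto F (𝓝[{p | p.2.1 ≤ p.1}] (t₀, s₀, x₀)) (𝓝 0) := by
    rw [← hF0]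
    exact (hF.tendsto _).mono_left nhdsWithin_le_nhds
  refine tendsto_iff_dist_tendsto_zero.2 (squeeze_zero' (Eventually.of_forall fun _ => dist_nonneg)
    ?_ hlim)
  have hev : ∀ᶠ p : ℝ × ℝ × Cone N in 𝓝 (t₀, s₀, x₀),
      p.1 < c ∧ a < p.2.1 ∧ p.2.1 < c ∧ ‖(p.2.2 : E N) - x₀‖ < 1 := by
    refine (IsOpen.mem_nhds (s := {p : ℝ × ℝ × Cone N |
      p.1 < c ∧ a < p.2.1 ∧ p.2.1 < c ∧ ‖(p.2.2 : E N) - x₀‖ < 1}) ?_ ?_)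
    · simp only [ofPred_and]
      refine (isOpen_lt ?_ ?_).inter ((isOpen_lt ?_ ?_).inter ((isOpen_lt ?_ ?_).inter
        (isOpen_lt ?_ ?_))) <;> fun_prop
    · refine ⟨by simp [c], by simp [a], ?_, by simp⟩
      simp only [c]
      linarith
  filter_upwards [self_mem_nhdsWithin, nhdsWithin_le_nhds hev] with p hp hp'
  obtain ⟨t, s, x⟩ := p
  obtain ⟨htc, has, hsc, hxx⟩ := hp'
  replace hp : s ≤ t := hp
  simp only at htc has hsc hxx
  change ‖(S t s x : E N) - S t₀ s₀ x₀‖ ≤ _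
  have key : ‖(S t s x : E N) - S (max t s₀) s₀ x₀‖ ≤
      (‖(x : E N) - x₀‖ + |∫ u in s..s₀, m u|) * Real.exp L := by
    have hb1 := hbox s x has.le hxx.le
    have hb2 := hbox s₀ x₀ (by simp [a]) (by simp)
    have has₀ : a ≤ s₀ := by simp [a]
    have hs₀c : s₀ ≤ c := by simp only [c]; linarith
    rcases le_total s s₀ with h | h
    · have := norm_sub_le_of_le_start hcomp hsol hm (fun _ => norm_nonneg _) hmK hl
        (fun _ => norm_nonneg _) hlK has.le h hs₀c htc.le hb1 hb2
      rw [max_eq_left hp] at this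
      exact this.trans (mul_le_mul_of_nonneg_right (add_le_add le_rfl (le_abs_self _))
        (Real.exp_pos _).le)
    · have := norm_sub_le_of_le_start hcomp hsol hm (fun _ => norm_nonneg _) hmK hl
        (fun _ => norm_nonneg _) hlK has₀ h hsc.le htc.le hb2 hb1
      rw [max_eq_left hp, norm_sub_rev, norm_sub_rev (x₀ : E N)] at this
      refine this.trans (mul_le_mul_of_nonneg_right (add_le_add le_rfl ?_) (Real.exp_pos _).le)
      rw [intervalIntegral.integral_symm s s₀]
      exact neg_le_abs _
  calc ‖(S t s x : E N) - S t₀ s₀ x₀‖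
      = ‖((S t s x : E N) - S (max t s₀) s₀ x₀) + (S (max t s₀) s₀ x₀ - S t₀ s₀ x₀)‖ := by
        congr 1; abel
    _ ≤ F (t, s, x) := (norm_add_le _ _).trans (add_le_add key le_rfl)

theorem exists_isInducedProcess (hf : IsLC f) (hA1 : CondA1 f) (hA2 : CondA2 f A b) :
    ∃ S : ℝ → ℝ → Cone N → Cone N, IsInducedProcess f S := by
  choose φ hφ hφ0 using fun (s : ℝ) (x₀ : Cone N) =>
    exists_nonneg_isSolutionOn_Ici hf hA1 hA2 s x₀.2
  set S : ℝ → ℝ → Cone N → Cone N := fun t s x₀ =>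
    ⟨φ s x₀ (max t s), hφ0 s x₀ _ (mem_Ici.2 (le_max_right _ _))⟩
  have hS : ∀ (s : ℝ) (x₀ : Cone N), EqOn (fun t => (S t s x₀ : E N)) (φ s x₀) (Ici s) :=
    fun s x₀ t ht => by
      change φ s x₀ (max t s) = φ s x₀ t
      rw [max_eq_left ht]
  have hsol : ∀ (s : ℝ) (x₀ : Cone N),
      IsSolutionOn f s (x₀ : E N) (Ici s) (fun t => (S t s x₀ : E N)) := by
    intro s x₀
    have hfS : ∀ t ∈ Ici s, EqOn (fun u => f u (φ s x₀ u)) (fun u => f u (S u s x₀)) (uIcc s t) :=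
      fun t ht u hu => by
        rw [uIcc_of_le ht] at hu
        exact (congrArg (f u) (hS s x₀ hu.1)).symm
    refine ⟨(hφ s x₀).cont.congr (hS s x₀), fun t ht => ?_, fun t ht => ?_⟩
    · exact ((hφ s x₀).integrable t ht).congr ((hfS t ht).mono uIoc_subset_uIcc)
    · rw [← intervalIntegral.integral_congr (hfS t ht)]
      exact (hS s x₀ ht).trans ((hφ s x₀).eqn t ht)
  exact ⟨S, isProcess_of_isSolutionOn hf hA2 hsol, hsol, fun s T x₀ y hy t ht =>
    hy.eq_of_isLC hf ((hsol s x₀).mono Icc_subset_Ici_self) t ht⟩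

end InducedProcess

/-! ### Comparison with the linear equation -/

section Comparison

open Set Matrix

variable {N : ℕ} {f : ℝ → E N → E N} {A Φ : ℝ → Matrix (Fin N) (Fin N) ℝ} {b : ℝ → E N}

instance properSpace_cone (N : ℕ) : ProperSpace (Cone N) :=
  ProperSpace.of_isClosed (X := E N) (s := {x | ∀ i, 0 ≤ x i}) (by
    simp only [ofPred_forall]
    exact isClosed_iInter fun i => isClosed_le continuous_const (by fun_prop))

/-- Suppose `w i ≤ 0`. A positive `w j` has `j ≠ i` and contributes nonnegatively to row `i`; a
nonpositive one contributes at least `entrySum A * w j`. This is the quasipositivity required by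
`nonneg_of_integral_of_quasipositive`. -/
theorem CondA2.nonneg_of_linear_le (hA2 : CondA2 f A b) {w φ : Fin N → ℝ → ℝ} {s T : ℝ}
    (hw : ∀ i, ContinuousOn (w i) (Icc s T))
    (hφ : ∀ i, IntervalIntegrable (φ i) volume s T)
    (heq : ∀ i, ∀ t ∈ Icc s T, w i t = w i s + ∫ u in s..t, φ i u)
    (h0 : ∀ i, 0 ≤ w i s)
    (h : ∀ᵐ u, u ∈ Icc s T → ∀ i, ∑ j, A u i j * w j u ≤ φ i u) :
    ∀ t ∈ Icc s T, ∀ i, 0 ≤ w i t := by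
  have hq : ∀ᵐ u, ∀ i j, i ≠ j → 0 ≤ A u i j := by
    refine ae_all_iff.2 fun i => ae_all_iff.2 fun j => ?_
    by_cases hij : i = j
    · simp [hij]
    · filter_upwards [hA2.quasiMonotone i j hij] with u hu _ using hu
  refine nonneg_of_integral_of_quasipositive hA2.locallyIntegrable_entrySum (entrySum_nonneg A)
    hw hφ heq h0 ?_
  filter_upwards [h, hq] with u hu hqu huT i hi
  refine le_trans ?_ (hu huT i)
  rw [Finset.mul_sum, ← Finset.sum_neg_distrib]
  refine Finset.sum_le_sum fun j _ => ?_
  rcases le_or_gt (w j u) 0 with hj | hj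
  · rw [max_eq_left (neg_nonneg.2 hj), mul_neg, neg_neg]
    exact mul_le_mul_of_nonpos_right ((le_abs_self _).trans (abs_entry_le_entrySum A u i j)) hj
  · rw [max_eq_right (neg_nonpos.2 hj.le), mul_zero, neg_zero]
    refine mul_nonneg (hqu i j ?_) hj.le
    rintro rfl
    exact absurd hi (not_le.2 hj)

namespace IsFundamentalMatrix

theorem continuous_entry (h : IsFundamentalMatrix A Φ) (i j : Fin N) :
    Continuous fun t => Φ t i j := h.cont.matrix_elem i j

theorem intervalIntegrable (h : IsFundamentalMatrix A Φ) (hA2 : CondA2 f A b) (i j : Fin N)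
    (s t : ℝ) : IntervalIntegrable (fun u => (A u * Φ u) i j) volume s t := by
  have hk : ∀ k, IntervalIntegrable (fun u => A u i k * Φ u k j) volume s t := fun k =>
    ((hA2.locInt_A i k).intervalIntegrable_real s t).mul_continuousOn
      (h.continuous_entry k j).continuousOn
  simp only [mul_apply]
  exact ⟨integrable_finsetSum Finset.univ fun k _ => (hk k).1, integrable_finsetSum Finset.univ fun k _ => (hk k).2⟩

theorem eq_add_integral (h : IsFundamentalMatrix A Φ) (hA2 : CondA2 f A b) (i j : Fin N)
    (s t : ℝ) : Φ t i j = Φ s i j + ∫ u in s..t, (A u * Φ u) i j := by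
  rw [h.eqn t, h.eqn s, add_assoc, intervalIntegral.integral_add_adjacent_intervals
    (h.intervalIntegrable hA2 i j 0 s) (h.intervalIntegrable hA2 i j s t)]

theorem mulVec_eq_add_integral (h : IsFundamentalMatrix A Φ) (hA2 : CondA2 f A b) (v : Fin N → ℝ)
    (i : Fin N) (s t : ℝ) :
    (Φ t *ᵥ v) i = (Φ s *ᵥ v) i + ∫ u in s..t, ((A u * Φ u) *ᵥ v) i := by
  simp only [mulVec, dotProduct]
  rw [intervalIntegral.integral_finsetSum fun j _ =>
    (h.intervalIntegrable hA2 i j s t).mul_const _, ← Finset.sum_add_distrib]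
  refine Finset.sum_congr rfl fun j _ => ?_
  rw [intervalIntegral.integral_mul_const, ← add_mul, ← h.eq_add_integral hA2]

theorem mulVec_zero_nonneg (h : IsFundamentalMatrix A Φ) (hA2 : CondA2 f A b) {s : ℝ}
    (hs : s ≤ 0) {v : Fin N → ℝ} (hv : Φ s *ᵥ v = 0) (i : Fin N) : 0 ≤ v i := by
  have h1 := hA2.nonneg_of_linear_le (w := fun i t => (Φ t *ᵥ v) i)
    (φ := fun i u => ((A u * Φ u) *ᵥ v) i) (s := s) (T := 0)
    (fun i => ?_) (fun i => ?_) (fun i t _ => h.mulVec_eq_add_integral hA2 v i s t)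
    (fun i => by simp [hv]) (Eventually.of_forall fun u _ i => ?_) 0 ⟨hs, le_rfl⟩ i
  · have h0 : Φ 0 = 1 := by
      ext i j
      simpa using h.eqn 0 i j
    simpa [h0] using h1
  · simp only [mulVec, dotProduct]
    exact (continuous_finsetSum _ fun j _ =>
      (h.continuous_entry i j).mul continuous_const).continuousOn
  · have hk := fun j => (h.intervalIntegrable hA2 i j s 0).mul_const (v j)
    exact ⟨integrable_finsetSum Finset.univ fun k _ => (hk k).1,
      integrable_finsetSum Finset.univ fun k _ => (hk k).2⟩
  · rw [← mulVec_mulVec]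
    exact le_rfl

/-- Invertibility comes from order preservation: if `Φ s` kills `v`, comparison from `s` up to `0`,
where `Φ 0 = 1`, gives `0 ≤ v`, and likewise `0 ≤ -v`. -/
theorem det_ne_zero (h : IsFundamentalMatrix A Φ) (hA2 : CondA2 f A b) {s : ℝ} (hs : s ≤ 0) :
    (Φ s).det ≠ 0 := by
  intro hdet
  obtain ⟨v, hv0, hv⟩ := exists_mulVec_eq_zero_iff.2 hdet
  refine hv0 (funext fun i => le_antisymm ?_ (h.mulVec_zero_nonneg hA2 hs hv i))
  have := h.mulVec_zero_nonneg hA2 hs (v := -v) (by rw [mulVec_neg, hv, neg_zero]) i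
  simpa using this

theorem continuousOn_inv (h : IsFundamentalMatrix A Φ) (hA2 : CondA2 f A b) (i j : Fin N) :
    ContinuousOn (fun u => (Φ u)⁻¹ i j) (Iic 0) := fun u hu => by
  have h1 : ContinuousAt (fun u => (Φ u)⁻¹) u := by
    refine ContinuousAt.comp (f := Φ) (g := Inv.inv) (continuousAt_matrix_inv _ ?_)
      h.cont.continuousAt
    rw [Ring.inverse_eq_inv']
    exact continuousAt_inv₀ (h.det_ne_zero hA2 hu)
  have h2 : Continuous fun M : Matrix (Fin N) (Fin N) ℝ => M i j := by fun_prop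
  exact (h2.continuousAt.comp h1).continuousWithinAt

theorem mulVec_inv_mulVec (h : IsFundamentalMatrix A Φ) (hA2 : CondA2 f A b) {s : ℝ} (hs : s ≤ 0)
    (v : Fin N → ℝ) : Φ s *ᵥ ((Φ s)⁻¹ *ᵥ v) = v := by
  rw [mulVec_mulVec, mul_nonsing_inv _ (Ne.isUnit (h.det_ne_zero hA2 hs)), one_mulVec]

end IsFundamentalMatrix

/-- Nonnegative solutions are bounded by the solution of `y' = A(t) y + b(t)`, written with the
variation of constants formula. -/
theorem coord_le_variation_of_constants (hf : IsLC f) (hA2 : CondA2 f A b)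
    (hΦ : IsFundamentalMatrix A Φ) {s : ℝ} {x₀ : E N} {x : ℝ → E N}
    (hx : IsSolutionOn f s x₀ (Icc s 0) x) (hx0 : ∀ t ∈ Icc s 0, ∀ i, 0 ≤ x t i)
    (hγ : ∀ j, IntervalIntegrable (fun u => ((Φ u)⁻¹ *ᵥ (b u).ofLp) j) volume s 0) :
    ∀ t ∈ Icc s 0, ∀ i, x t i ≤
      ∑ j, Φ t i j * (((Φ s)⁻¹ *ᵥ x₀.ofLp) j + ∫ u in s..t, ((Φ u)⁻¹ *ᵥ (b u).ofLp) j) := by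
  intro T hT
  have hs0 : s ≤ 0 := hT.1.trans hT.2
  have hss : s ∈ Icc s 0 := ⟨le_rfl, hs0⟩
  set γ : Fin N → ℝ → ℝ := fun j u => ((Φ u)⁻¹ *ᵥ (b u).ofLp) j
  set c : Fin N → ℝ → ℝ := fun j t => ((Φ s)⁻¹ *ᵥ x₀.ofLp) j + ∫ u in s..t, γ j u
  set y : Fin N → ℝ → ℝ := fun i t => ∑ j, Φ t i j * c j t
  set ψ : Fin N → ℝ → ℝ := fun i u => ∑ j, ((A u * Φ u) i j * c j u + Φ u i j * γ j u)
  have hsub : ∀ {t}, t ∈ Icc s 0 → uIcc s t ⊆ Icc s 0 := fun ht => by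
    rw [uIcc_of_le ht.1]; exact Icc_subset_Icc le_rfl ht.2
  have hγt : ∀ j, ∀ t ∈ Icc s 0, IntervalIntegrable (γ j) volume s t := fun j t ht =>
    (hγ j).mono_set (by rw [uIcc_of_le hs0]; exact hsub ht)
  have hcc : ∀ j, ContinuousOn (c j) (Icc s 0) := fun j => by
    refine continuousOn_const.add ?_
    have := intervalIntegral.continuousOn_primitive_interval' (hγ j) left_mem_uIcc
    rwa [uIcc_of_le hs0] at this
  have hψj : ∀ i j, ∀ t ∈ Icc s 0,
      IntervalIntegrable (fun u => (A u * Φ u) i j * c j u + Φ u i j * γ j u) volume s t :=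
    fun i j t ht => ((hΦ.intervalIntegrable hA2 i j s t).mul_continuousOn
      ((hcc j).mono (hsub ht))).add ((hγt j t ht).continuousOn_mul
        (hΦ.continuous_entry i j).continuousOn)
  have hψ : ∀ i, ∀ t ∈ Icc s 0, IntervalIntegrable (ψ i) volume s t := fun i t ht =>
    ⟨integrable_finsetSum _ fun j _ => (hψj i j t ht).1,
      integrable_finsetSum _ fun j _ => (hψj i j t ht).2⟩
  have hy : ∀ i, ∀ t ∈ Icc s 0, y i t = y i s + ∫ u in s..t, ψ i u := by
    intro i t ht
    rw [intervalIntegral.integral_finsetSum fun j _ => hψj i j t ht, ← Finset.sum_add_distrib]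
    refine Finset.sum_congr rfl fun j _ => ?_
    exact mul_eq_add_integral_of_eq_add_integral (F := fun t => Φ t i j) (G := c j) ht.1
      (hΦ.intervalIntegrable hA2 i j s t) (hγt j t ht)
      (fun r _ => hΦ.eq_add_integral hA2 i j s r) (fun r _ => by simp [c])
  have hys : ∀ i, y i s = x₀ i := fun i => by
    have := congrFun (hΦ.mulVec_inv_mulVec hA2 hs0 x₀.ofLp) i
    simpa [y, c, mulVec, dotProduct] using this
  have hψeq : ∀ u ∈ Icc s 0, ∀ i, ψ i u = ∑ k, A u i k * y k u + b u i := by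
    intro u hu i
    have h1 : ψ i u = ((A u * Φ u) *ᵥ (fun j => c j u)) i + (Φ u *ᵥ (fun j => γ j u)) i := by
      simp only [ψ, mulVec, dotProduct, Finset.sum_add_distrib]
    have h2 : (Φ u *ᵥ (fun j => γ j u)) i = b u i :=
      congrFun (hΦ.mulVec_inv_mulVec hA2 hu.2 (b u).ofLp) i
    rw [h1, h2, ← mulVec_mulVec]
    rfl
  have hfi := fun i => intervalIntegrable_coord (hx.integrable 0 ⟨hs0, le_rfl⟩) i
  have hyc : ∀ i, ContinuousOn (y i) (Icc s 0) := fun i =>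
    continuousOn_finsetSum _ fun j _ => (hΦ.continuous_entry i j).continuousOn.mul (hcc j)
  -- With `y' = A y + b` and `x' ≤ A x + b`, the difference vanishes at `s` and satisfies `w' ≥ A
  -- w`.
  have key := hA2.nonneg_of_linear_le (w := fun i t => y i t - x t i)
    (φ := fun i u => ψ i u - f u (x u) i) (s := s) (T := 0)
    (fun i => (hyc i).sub (hx.continuousOn_coord i))
    (fun i => (hψ i 0 ⟨hs0, le_rfl⟩).sub (hfi i))
    (fun i t ht => by
      rw [intervalIntegral.integral_sub (hψ i t ht)
        (intervalIntegrable_coord (hx.integrable t ht) i), hy i t ht, hx.coord_eq ht i,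
        hx.apply_left hss]
      ring)
    (fun i => by rw [hys, hx.apply_left hss, sub_self])
    (by
      filter_upwards [hA2.ae_le hf] with u hu hus i
      have := hu (x u) (hx0 u hus) i
      rw [hψeq u hus i]
      simp only [mul_sub, Finset.sum_sub_distrib]
      linarith)
  intro i
  exact sub_nonneg.1 (key T hT i)

theorem norm_le_of_isSolutionOn (hf : IsLC f) (hA2 : CondA2 f A b)
    (hΦ : IsFundamentalMatrix A Φ) {α K : ℝ}
    (hK : ∀ s t : ℝ, s ≤ t → t ≤ 0 →
      ‖toEuclideanCLM (n := Fin N) (𝕜 := ℝ) (Φ t * (Φ s)⁻¹)‖ ≤ K * Real.exp (-α * (t - s)))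
    {s : ℝ} {x₀ : E N} {x : ℝ → E N}
    (hx : IsSolutionOn f s x₀ (Icc s 0) x) (hx0 : ∀ t ∈ Icc s 0, ∀ i, 0 ≤ x t i) :
    ∀ t ∈ Icc s 0, ‖x t‖ ≤ K * Real.exp (-α * (t - s)) * ‖x₀‖ +
      K * ∫ u in s..t, Real.exp (-α * (t - u)) * ‖b u‖ := by
  intro t ht
  have hs0 : s ≤ 0 := ht.1.trans ht.2
  have hγ : ∀ j, IntervalIntegrable (fun u => ((Φ u)⁻¹ *ᵥ (b u).ofLp) j) volume s 0 := fun j => by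
    have hk : ∀ k, IntervalIntegrable (fun u => (Φ u)⁻¹ j k * b u k) volume s 0 := fun k =>
      ((hA2.locInt_b.coord k).intervalIntegrable_real s 0).continuousOn_mul
        ((hΦ.continuousOn_inv hA2 j k).mono (by
          rw [uIcc_of_le hs0]; exact Icc_subset_Iic_self))
    exact ⟨integrable_finsetSum Finset.univ fun k _ => (hk k).1,
      integrable_finsetSum Finset.univ fun k _ => (hk k).2⟩
  have hγt : ∀ j, IntervalIntegrable (fun u => ((Φ u)⁻¹ *ᵥ (b u).ofLp) j) volume s t := fun j =>
    (hγ j).mono_set (by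
      rw [uIcc_of_le hs0, uIcc_of_le ht.1]; exact Icc_subset_Icc le_rfl ht.2)
  set U : ℝ → E N →L[ℝ] E N := fun u => toEuclideanCLM (n := Fin N) (𝕜 := ℝ) (Φ t * (Φ u)⁻¹)
  have hU : ∀ u (v : E N) i, U u v i = ∑ j, Φ t i j * ((Φ u)⁻¹ *ᵥ v.ofLp) j := fun u v i => by
    have : (U u v).ofLp = (Φ t * (Φ u)⁻¹) *ᵥ v.ofLp := ofLp_toEuclideanCLM _ _
    rw [this, ← mulVec_mulVec]
    rfl
  have hUb : IntervalIntegrable (fun u => U u (b u)) volume s t := by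
    have hi : ∀ i, IntervalIntegrable (fun u => U u (b u) i) volume s t := fun i => by
      simp only [hU]
      exact ⟨integrable_finsetSum _ fun j _ => (hγt j).1.const_mul _,
        integrable_finsetSum _ fun j _ => (hγt j).2.const_mul _⟩
    exact ⟨Integrable.of_eval_piLp fun i => (hi i).1, Integrable.of_eval_piLp fun i => (hi i).2⟩
  have hle : ‖x t‖ ≤ ‖U s x₀ + ∫ u in s..t, U u (b u)‖ := by
    refine norm_le_norm_of_abs_le fun i => ?_
    rw [abs_of_nonneg (hx0 t ht i)]
    refine le_trans ?_ (le_abs_self _)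
    rw [PiLp.add_apply, intervalIntegral_coord hUb, hU]
    simp only [hU]
    rw [intervalIntegral.integral_finsetSum fun j _ => (hγt j).const_mul _,
      ← Finset.sum_add_distrib]
    simp only [intervalIntegral.integral_const_mul, ← mul_add]
    exact coord_le_variation_of_constants hf hA2 hΦ hx hx0 hγ t ht i
  refine hle.trans ((norm_add_le _ _).trans (add_le_add ?_ ?_))
  · exact ((U s).le_opNorm x₀).trans (mul_le_mul_of_nonneg_right (hK s t ht.1 ht.2)
      (norm_nonneg _))
  · rw [← intervalIntegral.integral_const_mul]
    refine intervalIntegral.norm_integral_le_of_norm_le ht.1 (Eventually.of_forall fun u hu => ?_)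
      (((hA2.locInt_b.norm_real.intervalIntegrable_real s t).continuousOn_mul
        (by fun_prop)).const_mul K)
    rw [← mul_assoc]
    exact ((U u).le_opNorm _).trans (mul_le_mul_of_nonneg_right (hK u t hu.2 ht.2) (norm_nonneg _))

/-- Translation boundedness in `L¹_loc` bounds the convolutions with a decaying exponential. -/
theorem exists_integral_exp_mul_le {g : ℝ → ℝ} (hg : LocallyIntegrable g volume)
    (hg0 : ∀ t, 0 ≤ g t) {C : ℝ} (hC : ∀ t, ∫ u in (t - 1)..t, g u ≤ C) {α : ℝ} (hα : 0 < α) :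
    ∃ M, 0 ≤ M ∧ ∀ s t, s ≤ t → ∫ u in s..t, Real.exp (-α * (t - u)) * g u ≤ M := by
  have hC0 : 0 ≤ C := (intervalIntegral.integral_nonneg (by linarith : (0 : ℝ) - 1 ≤ 0)
    fun u _ => hg0 u).trans (hC 0)
  have hα1 : Real.exp (-α) < 1 := by simpa using hα
  have hI : ∀ r a c, IntervalIntegrable (fun u => Real.exp (-α * (r - u)) * g u) volume a c :=
    fun r a c => (hg.intervalIntegrable_real a c).continuousOn_mul (by fun_prop)
  -- The sum of the geometric series of unit-interval contributions, and the fixed point of `M ↦ exp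
  -- (-α) * M + C` that drives the induction.
  set M := C / (1 - Real.exp (-α))
  have hM0 : 0 ≤ M := div_nonneg hC0 (by linarith)
  have hM : Real.exp (-α) * M + C = M := by
    have : (1 - Real.exp (-α)) ≠ 0 := by linarith
    simp only [M]
    field_simp
    ring
  have key : ∀ (n : ℕ) (t : ℝ), ∫ u in (t - n)..t, Real.exp (-α * (t - u)) * g u ≤ M := by
    intro n
    induction n with
    | zero => intro t; simpa using hM0
    | succ n ih =>
      intro t
      have e : t - ((n + 1 : ℕ) : ℝ) = (t - 1) - n := by push_cast; ring
      rw [e, ← intervalIntegral.integral_add_adjacent_intervals (hI t _ (t - 1)) (hI t _ _), ← hM]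
      refine add_le_add ?_ ?_
      · have : ∀ u, Real.exp (-α * (t - u)) * g u =
            Real.exp (-α) * (Real.exp (-α * ((t - 1) - u)) * g u) := fun u => by
          rw [← mul_assoc, ← Real.exp_add]
          congr 2
          ring
        simp only [this, intervalIntegral.integral_const_mul]
        exact mul_le_mul_of_nonneg_left (ih (t - 1)) (Real.exp_pos _).le
      · refine le_trans ?_ (hC t)
        refine intervalIntegral.integral_mono_on (by linarith) (hI t _ _)
          (hg.intervalIntegrable_real _ _) fun u hu => ?_
        refine mul_le_of_le_one_left (hg0 u) (Real.exp_le_one_iff.2 ?_)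
        nlinarith [hu.2]
  refine ⟨M, hM0, fun s t hst => ?_⟩
  obtain ⟨n, hn⟩ := exists_nat_ge (t - s)
  refine le_trans ?_ (key n t)
  exact intervalIntegral.integral_mono_interval (by linarith) hst le_rfl
    (Eventually.of_forall fun u => mul_nonneg (Real.exp_pos _).le (hg0 u)) (hI t _ _)

theorem exists_uniformlyAbsorbedByBalls (hf : IsLC f) (hA2 : CondA2 f A b) (hA3 : CondA3 A)
    (hA4 : CondA4 b) {S : ℝ → ℝ → Cone N → Cone N} (hS : IsInducedProcess f S) :
    ∃ R : ℝ → ℝ, UniformlyAbsorbedByBalls S ⟨0, fun _ => le_rfl⟩ R := by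
  obtain ⟨Φ, hΦ, α, K, hα, hK1, hK⟩ := hA3
  -- Radius `1 / 2` around `t - 1 / 2` is the unit window `[t - 1, t]`.
  obtain ⟨C, hC⟩ := hA4 (1 / 2) (by norm_num)
  obtain ⟨M, hM0, hM⟩ := exists_integral_exp_mul_le hA2.locInt_b.norm_real
    (fun _ => norm_nonneg _) (C := C) (fun t => by
      have := hC (t - 1 / 2)
      rw [intervalIntegral.integral_comp_add_right (fun u => ‖b u‖)] at this
      convert this using 2 <;> ring) hα
  have hball : ∀ (x : Cone N) (r : ℝ),
      x ∈ Metric.closedBall (⟨0, fun _ => le_rfl⟩ : Cone N) r ↔ ‖(x : E N)‖ ≤ r := fun x r => by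
    rw [Metric.mem_closedBall, Subtype.dist_eq, dist_zero_right]
  have hpast : ∀ D : Set (Cone N), Bornology.IsBounded D → ∃ T : ℝ, 0 < T ∧
      ∀ t s : ℝ, t ≤ 0 → T ≤ s → ∀ x ∈ D, ‖(S t (t - s) x : E N)‖ ≤ 1 + K * M := by
    intro D hD
    obtain ⟨ρ, hρ⟩ := hD.subset_closedBall (⟨0, fun _ => le_rfl⟩ : Cone N)
    have hlim : Tendsto (fun s : ℝ => K * Real.exp (-α * s) * |ρ|) atTop (𝓝 0) := by
      have h1 : Tendsto (fun s : ℝ => Real.exp (-α * s)) atTop (𝓝 0) :=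
        Real.tendsto_exp_atBot.comp (tendsto_id.const_mul_atTop_of_neg (neg_lt_zero.2 hα))
      simpa using (h1.const_mul K).mul_const |ρ|
    obtain ⟨T, hT⟩ := eventually_atTop.1 (hlim.eventually (ge_mem_nhds zero_lt_one))
    refine ⟨max T 1, by positivity, fun t s ht hs x hx => ?_⟩
    have hs1 : 1 ≤ s := (le_max_right _ _).trans hs
    have hxρ : ‖(x : E N)‖ ≤ |ρ| := ((hball x ρ).1 (hρ hx)).trans (le_abs_self _)
    have h1 := norm_le_of_isSolutionOn hf hA2 hΦ hK
      ((hS.solution (t - s) x).mono Icc_subset_Ici_self) (fun r _ => (S r (t - s) x).2) t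
      ⟨by linarith, ht⟩
    rw [sub_sub_cancel] at h1
    refine h1.trans (add_le_add ?_ ?_)
    · exact le_trans (by gcongr) (hT s ((le_max_left _ _).trans hs))
    · exact mul_le_mul_of_nonneg_left (hM _ _ (by linarith)) (by linarith)
  -- The dichotomy controls only times up to `0`. Beyond them, joint continuity of the process makes
  -- the image of `[0, τ]` times the absorbing ball compact. The lower bound on `R` keeps that ball
  -- inside for final times `t ≤ 0`.
  have hfut : ∀ τ : ℝ, ∃ R : ℝ, 1 + K * M ≤ R ∧ ∀ t ∈ Icc 0 τ, ∀ x : Cone N,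
      ‖(x : E N)‖ ≤ 1 + K * M → ‖(S t 0 x : E N)‖ ≤ R := by
    intro τ
    have hcpt : IsCompact ((fun p : ℝ × Cone N => (S p.1 0 p.2 : E N)) ''
        (Icc 0 τ ×ˢ Metric.closedBall ⟨0, fun _ => le_rfl⟩ (1 + K * M))) := by
      refine (isCompact_Icc.prod (isCompact_closedBall _ _)).image_of_continuousOn ?_
      refine continuous_subtype_val.comp_continuousOn ?_
      exact hS.process.cont.comp (f := fun p : ℝ × Cone N => (p.1, (0 : ℝ), p.2)) (by fun_prop)
        fun p hp => hp.1.1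
    obtain ⟨R, hR⟩ := hcpt.isBounded.exists_norm_le
    exact ⟨max R (1 + K * M), le_max_right _ _, fun t ht x hx =>
      (hR _ ⟨(t, x), ⟨ht, (hball _ _).2 hx⟩, rfl⟩).trans (le_max_left _ _)⟩
  choose R hR hRS using hfut
  refine ⟨R, fun τ D hD => ?_⟩
  obtain ⟨T, hT0, hT⟩ := hpast D hD
  -- The extra `|τ|` leaves at least `T` units of time before `0` when `0 ≤ t ≤ τ`.
  refine ⟨T + |τ|, by positivity, ?_⟩
  rintro t s ht hs _ ⟨x, hx, rfl⟩
  rw [hball]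
  rcases le_total t 0 with h | h
  · exact (hT t s h (by linarith [abs_nonneg τ]) x hx).trans (hR τ)
  · have hτ := le_abs_self τ
    rw [hS.process.comp (t - s) 0 t (by linarith) h]
    refine hRS τ t ⟨h, ht⟩ _ ?_
    have := hT 0 (s - t) le_rfl (by linarith) x hx
    rwa [zero_sub, neg_sub] at this

end Comparison

end PullbackCone

end

theorem mainTheorem12 (N : ℕ) (f : ℝ → PullbackCone.E N → PullbackCone.E N)
    (A : ℝ → Matrix (Fin N) (Fin N) ℝ) (b : ℝ → PullbackCone.E N)
    (hf : PullbackCone.IsLC f)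
    (hA1 : PullbackCone.CondA1 f)
    (hA2 : PullbackCone.CondA2 f A b)
    (hA3 : PullbackCone.CondA3 A)
    (hA4 : PullbackCone.CondA4 b) :
    ∃ S : ℝ → ℝ → PullbackCone.Cone N → PullbackCone.Cone N,
      PullbackCone.IsInducedProcess f S ∧
      (∀ τ : ℝ, PullbackCone.StronglyPullbackBoundedDissipative S τ) ∧
      ∃ 𝒜 : ℝ → Set (PullbackCone.Cone N),
        PullbackCone.IsPullbackAttractor S 𝒜 ∧ PullbackCone.BoundedInPast 𝒜 := by
  obtain ⟨S, hS⟩ := PullbackCone.exists_isInducedProcess hf hA1 hA2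
  obtain ⟨R, hR⟩ := PullbackCone.exists_uniformlyAbsorbedByBalls hf hA2 hA3 hA4 hS
  exact ⟨S, hS, hR.stronglyPullbackBoundedDissipative, hR.exists_isPullbackAttractor hS.process⟩
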